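/- **Setting.** Consider the Novikov equation $u_t+u^2u_x+\partial_xP_1+P_2=0$ on $\mathbb R$, with $P_1=p*(\tfrac32uu_x^2+u^3)$, $P_2=\tfrac12\,p*(u_x^3)$, $p=\tfrac12e^{-|x|}$. Fix $T>0$, $t\in[0,T]$ and $E_1,E_2>0$. Elements of $H^1(\mathbb R)\cap W^{1,4}(\mathbb R)$ are identified with their locally absolutely continuous representatives, and $\Sigma$ is the set of those $u$ with $\int(u^2+u_x^2)\,dx\le E_1$ and $\int u_x^4\,dx\le E_2$. *Solutions.* A conservative solution $U$ on $[0,T]$ is given by functions $(x,u,\alpha,\xi)(t,Y)$, $\xi>0$ ($\alpha$ is real valued and meaningful modulo $2\pi$), such that $x_Y=\xi\cos^4\frac\alpha2$, $u_Y=\frac12\xi\sin\alpha\cos^2\frac\alpha2$ and $$x_t=u^2,\quad u_t=-\partial_xP_1-P_2,\quad \alpha_t=-u\sin^2\tfrac\alpha2+2u^3\cos^2\tfrac\alpha2-2\cos^2\tfrac\alpha2\,(P_1+\partial_xP_2),\quad \xi_t=\xi\,[2u^3+u-2(P_1+\partial_xP_2)]\sin\alpha,$$ where, with $k(Y,Z)=e^{-|\int_Z^Y\xi\cos^4\frac\alpha2|}$,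 $g_1=(\frac38u\sin^2\alpha+u^3\cos^4\frac\alpha2)\xi$, $g_2=\xi\sin\alpha\sin^2\frac\alpha2$, $$P_1=\tfrac12\int_{\mathbb R}k\,g_1\,dZ,\quad \partial_xP_1=\tfrac12\Big(\int_Y^\infty-\int_{-\infty}^Y\Big)k\,g_1\,dZ,\quad P_2=\tfrac18\int_{\mathbb R}k\,g_2\,dZ,\quad \partial_xP_2=\tfrac18\Big(\int_Y^\infty-\int_{-\infty}^Y\Big)k\,g_2\,dZ,$$ with $x(0,0)=0$, $\alpha(0,Y)=2\arctan U_x(0,x(0,Y))$, $\xi(0,Y)=1$; the set $\{(t,x(t,Y),u(t,Y))\}$ is the graph of $U$ over $[0,T]\times\mathbb R$, and $U(t,\cdot)\in H^1\cap W^{1,4}$ for all $t\in[0,T]$. It has generic singularities if $x,u,\alpha,\xi$ are $C^\infty$ on $[0,T]\times\mathbb R$ and, wherever $\alpha\equiv\pi \pmod{2\pi}$ and $\alpha_Y=0$, one has $\alpha_t\ne0$ and $\alpha_{YY}\neq0$. Let $\mathcal D^\infty$ be the set of data in $C_c^\infty(\mathbb R)$ whose solution has generic singularities. *Paths.* A piecewise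 regular path is a family $\theta\mapsto u^\theta$, $\theta\in[0,1]$, of such solutions for which, at each $t\in[0,T]$, $(Y,\theta)\mapsto(x,u,\alpha,\xi)$ is continuous on $\mathbb R\times[0,1]$, and for which there is a finite set $B$ such that, at each $t\in[0,T]$, this map is $C^\infty$ on $\mathbb R\times((0,1)\setminus B)$ and $u^\theta$ has generic singularities for $\theta\in[0,1]\setminus B$. Its unweighted length at time $t$ is the infimum, over all shifts $q^\theta(Y)$ that are $C^\infty$ on $\mathbb R\times((0,1)\setminus B)$, of $$\int_0^1\int_{\mathbb R}\Big(|(x_\theta+x_Yq)\,\xi|+|(u_\theta+u_Yq)\,\xi|+\tfrac12|(\alpha_\theta+\alpha_Yq)\,\xi|+|\xi_\theta+\xi_Yq+\xi q_Y|\Big)\,dY\,d\theta .$$ For profiles $a,b$ at time $t$ of solutions with data in $\mathcal D^\infty$, let $d_0(a,b)\in[0,\infty]$ be the infimum of the unweighted lengths at time $t$ of all piecewise regular paths whose endpoints are solutions with data in $\mathcal D^\infty$ having the profiles $a$ and $b$ at time $t$, and such that $u^\theta(t)\in\Sigma$ for all $\theta$; put $d_0(a,b)=\infty$ for all other $a,b$.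 *The distance.* For $u,\tilde u\in H^1\cap W^{1,4}$ let $d_1(u,\tilde u)$ be the lower limit of $d_0(a,b)$ as $a\to u$, $b\to\tilde u$ in $H^1\cap W^{1,4}$. For $u,\tilde u\in X:=H^1\cap W^{1,4}\cap L^1$ let $$d^*(u,\tilde u)=\inf\Big\{\sum_{i=0}^{n-1}d_1(w_i,w_{i+1}):\ n\ge0,\ w_0,\dots,w_n\in X,\ w_0=u,\ w_n=\tilde u\Big\}\le d_1(u,\tilde u).$$ **Proposition 7.3 (Comparison with the Kantorovich–Rubinstein metric).** For every $T>0$ and $t\in[0,T]$, $d^*$ is a distance on $X$ with values in $[0,\infty]$. There is a constant $C>0$ depending only on $E_1,E_2$ such that, for all $T>0$, $t\in[0,T]$ and $u,\tilde u\in X$, $$\|u-\tilde u\|_{L^1}\le C\,d^*(u,\tilde u).$$ Moreover, for all such $T,t,u,\tilde u$, the function $(1+u_x^2)^2-(1+\tilde u_x^2)^2$ is integrable, and $$\sup_{f}\ \Big|\int_{\mathbb R}f\,\big[(1+u_x^2)^2-(1+\tilde u_x^2)^2\big]\,dx\Big|\le d^*(u,\tilde u),$$ where the supremum is over all $f\in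 C^1(\mathbb R)$ with $|f|\le1$ and $|f'|\le1$. (The integral is $\int f\,d\mu-\int f\,d\tilde\mu$ for the measures $\mu,\tilde\mu$ with densities $(1+u_x^2)^2$, $(1+\tilde u_x^2)^2$; both have infinite mass, so only the difference is defined.) -/

import Mathlib

open scoped ContDiff ENNReal

noncomputable section

namespace Novikov

/-! ### Function spaces on the line -/

/-- `u` is (the absolutely continuous representative of) an element of `H¹(ℝ) ∩ W^{1,4}(ℝ)`.
In one dimension the weak derivative of a Sobolev function is the a.e. derivative of its locally
absolutely continuous representative, so that `u_x` is `deriv u` throughout. -/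
structure MemH1W14 (u : ℝ → ℝ) : Prop where
  absCont : ∀ a b : ℝ, AbsolutelyContinuousOnInterval u a b
  memLp_two : MeasureTheory.MemLp u 2 MeasureTheory.volume
  memLp_four : MeasureTheory.MemLp u 4 MeasureTheory.volume
  deriv_memLp_two : MeasureTheory.MemLp (deriv u) 2 MeasureTheory.volume
  deriv_memLp_four : MeasureTheory.MemLp (deriv u) 4 MeasureTheory.volume

/-- The distance `‖a - u‖_{H¹ ∩ W^{1,4}}` (sum of the four norms), as an extended number. -/
def sobolevDist (a u : ℝ → ℝ) : ℝ≥0∞ :=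
  MeasureTheory.eLpNorm (fun x => a x - u x) 2 MeasureTheory.volume
    + MeasureTheory.eLpNorm (fun x => deriv a x - deriv u x) 2 MeasureTheory.volume
    + MeasureTheory.eLpNorm (fun x => a x - u x) 4 MeasureTheory.volume
    + MeasureTheory.eLpNorm (fun x => deriv a x - deriv u x) 4 MeasureTheory.volume

/-- The set `Σ`: energy `∫ (u² + u_x²) ≤ E₁` and `‖u_x‖_{L⁴}⁴ ≤ E₂`. -/
def MemSigma (E₁ E₂ : ℝ) (u : ℝ → ℝ) : Prop :=
  MemH1W14 u ∧ (∫ x, (u x ^ 2 + deriv u x ^ 2)) ≤ E₁ ∧ (∫ x, deriv u x ^ 4) ≤ E₂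

/-! ### Solutions of the Novikov equation in characteristic coordinates -/

/-- The unknowns of the semilinear system, as functions of `(t, Y)`, together with
the solution `U (t, x)` in the original variables. -/
structure CharData where
  x : ℝ → ℝ → ℝ
  u : ℝ → ℝ → ℝ
  α : ℝ → ℝ → ℝ
  ξ : ℝ → ℝ → ℝ
  U : ℝ → ℝ → ℝ

namespace CharData

/-- The kernel `exp (-|∫_Z^Y ξ cos⁴(α/2)|)`, which is `exp (-|x(t,Y) - x(t,Z)|)`. -/
def kernel (S : CharData) (t Y Z : ℝ) : ℝ :=
  Real.exp (-|∫ s in Z..Y, S.ξ t s * Real.cos (S.α t s / 2) ^ 4|)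

/-- `(3/8 u sin² α + u³ cos⁴(α/2)) ξ`, the density of `(3/2 u u_x² + u³) dx` in `Y`. -/
def source₁ (S : CharData) (t Z : ℝ) : ℝ :=
  (3 / 8 * S.u t Z * Real.sin (S.α t Z) ^ 2
    + S.u t Z ^ 3 * Real.cos (S.α t Z / 2) ^ 4) * S.ξ t Z

/-- `ξ sin α sin²(α/2)`, twice the density of `u_x³ dx` in `Y`. -/
def source₂ (S : CharData) (t Z : ℝ) : ℝ :=
  S.ξ t Z * Real.sin (S.α t Z) * Real.sin (S.α t Z / 2) ^ 2

def P₁ (S : CharData) (t Y : ℝ) : ℝ :=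
  1 / 2 * ∫ Z, S.kernel t Y Z * S.source₁ t Z

/-- `∂ₓ P₁` -/
def dxP₁ (S : CharData) (t Y : ℝ) : ℝ :=
  1 / 2 * ((∫ Z in Set.Ioi Y, S.kernel t Y Z * S.source₁ t Z)
    - ∫ Z in Set.Iic Y, S.kernel t Y Z * S.source₁ t Z)

def P₂ (S : CharData) (t Y : ℝ) : ℝ :=
  1 / 8 * ∫ Z, S.kernel t Y Z * S.source₂ t Z

/-- `∂ₓ P₂` -/
def dxP₂ (S : CharData) (t Y : ℝ) : ℝ :=
  1 / 8 * ((∫ Z in Set.Ioi Y, S.kernel t Y Z * S.source₂ t Z)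
    - ∫ Z in Set.Iic Y, S.kernel t Y Z * S.source₂ t Z)

/-- `S` is a conservative solution on `[0, T]` of the Novikov equation
`u_t + u² u_x + ∂ₓ P₁ + P₂ = 0`, written in the characteristic coordinates `(t, Y)`:
`Y` is constant along the characteristics `dx/dt = u²`, `α = 2 arctan u_x` and
`ξ = (1 + u_x²)² / Y_x`. The angle `α` is real valued, and meaningful modulo `2π` only. -/
structure IsSolution (T : ℝ) (S : CharData) : Prop where
  ξ_pos : ∀ t ∈ Set.Icc 0 T, ∀ Y, 0 < S.ξ t Y
  /- The meaning of `ξ` and `α`: `x_Y = ξ cos⁴(α/2)` and `u_Y = u_x x_Y`. -/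
  x_Y : ∀ t ∈ Set.Icc 0 T, ∀ Y,
    HasDerivAt (fun Z => S.x t Z) (S.ξ t Y * Real.cos (S.α t Y / 2) ^ 4) Y
  u_Y : ∀ t ∈ Set.Icc 0 T, ∀ Y,
    HasDerivAt (fun Z => S.u t Z)
      (1 / 2 * S.ξ t Y * Real.sin (S.α t Y) * Real.cos (S.α t Y / 2) ^ 2) Y
  /- The semilinear system. -/
  x_t : ∀ t ∈ Set.Icc 0 T, ∀ Y,
    HasDerivWithinAt (fun s => S.x s Y) (S.u t Y ^ 2) (Set.Icc 0 T) t
  u_t : ∀ t ∈ Set.Icc 0 T, ∀ Y,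
    HasDerivWithinAt (fun s => S.u s Y) (-S.dxP₁ t Y - S.P₂ t Y) (Set.Icc 0 T) t
  α_t : ∀ t ∈ Set.Icc 0 T, ∀ Y,
    HasDerivWithinAt (fun s => S.α s Y)
      (-S.u t Y * Real.sin (S.α t Y / 2) ^ 2
        + 2 * S.u t Y ^ 3 * Real.cos (S.α t Y / 2) ^ 2
        - 2 * Real.cos (S.α t Y / 2) ^ 2 * (S.P₁ t Y + S.dxP₂ t Y)) (Set.Icc 0 T) t
  ξ_t : ∀ t ∈ Set.Icc 0 T, ∀ Y,
    HasDerivWithinAt (fun s => S.ξ s Y)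
      (S.ξ t Y * ((2 * S.u t Y ^ 3 + S.u t Y) - 2 * (S.P₁ t Y + S.dxP₂ t Y))
        * Real.sin (S.α t Y)) (Set.Icc 0 T) t
  /- The initial conditions; those on `x` and `ξ` say that `Y = ∫₀ˣ (1 + u_x²)²` at `t = 0`. -/
  x_init : S.x 0 0 = 0
  α_init : ∀ Y, S.α 0 Y = 2 * Real.arctan (deriv (S.U 0) (S.x 0 Y))
  ξ_init : ∀ Y, S.ξ 0 Y = 1
  /- `{(t, x(t,Y), u(t,Y))}` is the graph of `U` over `[0, T] × ℝ`. -/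
  x_surj : ∀ t ∈ Set.Icc 0 T, Function.Surjective (S.x t)
  graph : ∀ t ∈ Set.Icc 0 T, ∀ Y, S.U t (S.x t Y) = S.u t Y
  memH1W14 : ∀ t ∈ Set.Icc 0 T, MemH1W14 (S.U t)

/-- Generic singularities for `t ∈ [0, T]`: `x, u, α, ξ` are `C^∞` in `(t, Y)`, and
`α = π` (modulo `2π`), `α_Y = 0` imply `α_t ≠ 0`, `α_YY ≠ 0`. -/
structure IsGeneric (T : ℝ) (S : CharData) : Prop where
  smooth_x : ContDiffOn ℝ ∞ (fun p : ℝ × ℝ => S.x p.1 p.2) (Set.Icc 0 T ×ˢ Set.univ)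
  smooth_u : ContDiffOn ℝ ∞ (fun p : ℝ × ℝ => S.u p.1 p.2) (Set.Icc 0 T ×ˢ Set.univ)
  smooth_α : ContDiffOn ℝ ∞ (fun p : ℝ × ℝ => S.α p.1 p.2) (Set.Icc 0 T ×ˢ Set.univ)
  smooth_ξ : ContDiffOn ℝ ∞ (fun p : ℝ × ℝ => S.ξ p.1 p.2) (Set.Icc 0 T ×ˢ Set.univ)
  generic : ∀ t ∈ Set.Icc 0 T, ∀ Y, Real.cos (S.α t Y / 2) = 0 →
    deriv (fun Z => S.α t Z) Y = 0 →
      derivWithin (fun s => S.α s Y) (Set.Icc 0 T) t ≠ 0 ∧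
        iteratedDeriv 2 (fun Z => S.α t Z) Y ≠ 0

/-- `S` is a solution with initial datum in `𝒟^∞ = 𝒞_c^∞ ∩ 𝒟`: the datum is smooth and
compactly supported, and the solution has generic singularities only. -/
structure IsDInfty (T : ℝ) (S : CharData) : Prop where
  solution : S.IsSolution T
  smooth_init : ContDiff ℝ ∞ (S.U 0)
  compact_init : HasCompactSupport (S.U 0)
  generic : S.IsGeneric T

end CharData

/-! ### Piecewise regular paths, their unweighted length, and the distance -/

/-- `θ ↦ S θ`, `θ ∈ [0, 1]`, is a path of solutions, piecewise regular for `t ∈ [0, T]`, with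
exceptional parameters in the finite set `B`. -/
structure IsPiecewiseRegular (T : ℝ) (B : Finset ℝ) (S : ℝ → CharData) : Prop where
  solution : ∀ θ ∈ Set.Icc (0 : ℝ) 1, (S θ).IsSolution T
  /- Continuity of `(Y, θ) ↦ (x, u, α, ξ)`. -/
  cont : ∀ t ∈ Set.Icc 0 T, ContinuousOn
    (fun p : ℝ × ℝ => ((S p.2).x t p.1, (S p.2).u t p.1, (S p.2).α t p.1, (S p.2).ξ t p.1))
    (Set.univ ×ˢ Set.Icc 0 1)
  /- Smoothness of `(Y, θ) ↦ (x, u, α, ξ)` between the exceptional parameters. -/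
  smooth : ∀ t ∈ Set.Icc 0 T, ContDiffOn ℝ ∞
    (fun p : ℝ × ℝ => ((S p.2).x t p.1, (S p.2).u t p.1, (S p.2).α t p.1, (S p.2).ξ t p.1))
    (Set.univ ×ˢ (Set.Ioo 0 1 \ (B : Set ℝ)))
  generic : ∀ θ ∈ Set.Icc (0 : ℝ) 1 \ (B : Set ℝ), (S θ).IsGeneric T

/-- The unweighted norm `∑_ℓ ∫ |J_ℓ| dY` of the tangent vector at `θ`, at time `t`, where
`q Y` is the shift `∂Y^ε/∂ε` at `ε = 0` of the relabelling `Y ↦ Y^ε` which matches the points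
of the profile at `θ` with those of the profile at `θ + ε`. The four terms are the change
in `x`, in `u`, in `arctan u_x`, and in the measure `ξ dY = (1 + u_x²)² dx`. -/
def tangentNorm (S : ℝ → CharData) (t θ : ℝ) (q : ℝ → ℝ) : ℝ≥0∞ :=
  (∫⁻ Y, ENNReal.ofReal |(deriv (fun η => (S η).x t Y) θ
      + deriv (fun Z => (S θ).x t Z) Y * q Y) * (S θ).ξ t Y|)
  + (∫⁻ Y, ENNReal.ofReal |(deriv (fun η => (S η).u t Y) θ
      + deriv (fun Z => (S θ).u t Z) Y * q Y) * (S θ).ξ t Y|)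
  + (∫⁻ Y, ENNReal.ofReal |1 / 2 * (deriv (fun η => (S η).α t Y) θ
      + deriv (fun Z => (S θ).α t Z) Y * q Y) * (S θ).ξ t Y|)
  + (∫⁻ Y, ENNReal.ofReal |deriv (fun η => (S η).ξ t Y) θ
      + deriv (fun Z => (S θ).ξ t Z) Y * q Y + (S θ).ξ t Y * deriv q Y|)

/-- The infimum of the unweighted lengths at time `t`, over all transportation plans `q`, of all
piecewise regular paths in `Σ` that join the time-`t` profiles `a` and `b` of two solutions
with data in `𝒟^∞` (it is `∞` if there is none, in particular if `a` or `b` is no such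
profile). -/
def pathDist (T t E₁ E₂ : ℝ) (a b : ℝ → ℝ) : ℝ≥0∞ :=
  ⨅ (S : ℝ → CharData) (B : Finset ℝ) (q : ℝ → ℝ → ℝ)
    (_ : IsPiecewiseRegular T B S)
    (_ : (S 0).IsDInfty T ∧ (S 0).U t = a)
    (_ : (S 1).IsDInfty T ∧ (S 1).U t = b)
    (_ : ∀ θ ∈ Set.Icc (0 : ℝ) 1, MemSigma E₁ E₂ ((S θ).U t))
    (_ : ContDiffOn ℝ ∞ (fun p : ℝ × ℝ => q p.2 p.1)
      (Set.univ ×ˢ (Set.Ioo 0 1 \ (B : Set ℝ)))),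
    ∫⁻ θ in Set.Ioo (0 : ℝ) 1, tangentNorm S t θ (q θ)

/-- The extension of `pathDist` by approximation: its lower limit as `a → u` and `b → ũ` in
`H¹ ∩ W^{1,4}`. -/
def limitDist (T t E₁ E₂ : ℝ) (u u' : ℝ → ℝ) : ℝ≥0∞ :=
  ⨆ (ε : ℝ≥0∞) (_ : 0 < ε),
    ⨅ (a : ℝ → ℝ) (b : ℝ → ℝ) (_ : sobolevDist a u < ε) (_ : sobolevDist b u' < ε),
      pathDist T t E₁ E₂ a b

/-- The space `H¹ ∩ W^{1,4} ∩ L¹` on which `d*` is a distance. -/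
def MemSpace (u : ℝ → ℝ) : Prop := MemH1W14 u ∧ MeasureTheory.Integrable u

/-- The (extended) distance `d*` at time `t`: the infimum of the lengths of all finite
concatenations, from `u` to `ũ`, of steps measured by `limitDist`. It never exceeds `limitDist`
(take one step), and equals it as soon as the latter is itself a distance. -/
def distStar (T t E₁ E₂ : ℝ) (u u' : ℝ → ℝ) : ℝ≥0∞ :=
  ⨅ (n : ℕ) (w : ℕ → ℝ → ℝ) (_ : ∀ i ≤ n, MemSpace (w i)) (_ : w 0 = u) (_ : w n = u'),
    ∑ i ∈ Finset.range n, limitDist T t E₁ E₂ (w i) (w (i + 1))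

/-! ### The Kantorovich-Rubinstein distance -/

/-- The density `(1 + u_x²)²`. -/
def density (u : ℝ → ℝ) (x : ℝ) : ℝ := (1 + deriv u x ^ 2) ^ 2

/-- `sup |∫ f dμ - ∫ f dμ̃|` over `f ∈ 𝒞¹` with `|f| ≤ 1`, `|f'| ≤ 1`. As `μ` and `μ̃` have
infinite mass, the difference is the integral of `f` against the difference of the
densities. -/
def kantorovichRubinstein (u u' : ℝ → ℝ) : ℝ≥0∞ :=
  ⨆ (f : ℝ → ℝ) (_ : ContDiff ℝ 1 f) (_ : ∀ x, |f x| ≤ 1) (_ : ∀ x, |deriv f x| ≤ 1),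
    ENNReal.ofReal |∫ x, f x * (density u x - density u' x)|

end Novikov

end

/-!
Both comparisons are instances of one scheme. For a functional `I` of the profile, if
`|I a - I b|` is at most the length of every path from `a` to `b`, and `I` is continuous for
`sobolevDist`, then `|I u - I u'|` is bounded by `limitDist`, and by the triangle inequality along
chains by `distStar` (`IsLocallyLipschitzFunctional.edist_le_distStar`). This is applied to
`I u = ∫ φ u` and to `I u = ∫ f (1 + u_x²)²`, with compactly supported `C¹` functions `φ`, `f` such
that `|φ| ≤ 1` and `|f|, |f'| ≤ 1`.

In characteristic coordinates `∫ φ u dx = ∫ φ(x) u x_Y dY` and `∫ f dμ = ∫ f(x) ξ dY`. Since the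
`x(·)` are proper, uniformly in `θ`, all integrands along a path live on one compact
interval of `Y`, so an arbitrary shift `q`, without any growth condition, gives no boundary terms.
Adding a `Y`-derivative to the `θ`-derivative of the integrand
(`enorm_integral_sub_le_of_balance_law`) one gets
* `∂_θ (φ(x) u x_Y) - ∂_Y (φ(x) u x_θ) = φ(x) (u_θ x_Y - u_Y x_θ)`. The Jacobian does not change
  when `q ∂_Y` is added to `∂_θ`, and `|x_Y|, |u_Y| ≤ ξ`, so it is bounded by the first two terms of
  `tangentNorm`;
* `∂_θ (f(x) ξ) + ∂_Y (q f(x) ξ) = f'(x) (x_θ + x_Y q) ξ + f(x) (ξ_θ + ξ_Y q + ξ q_Y)`, which is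
  bounded by the first and the last.

At the endpoints of a path, `∫ f(x) ξ dY` is the integral of `f` against the *density*
`(1 + u_x²)²`: generic singularities make `{α = π}` countable, so that the measure `ξ dY` has no
singular part (`CharData.IsGeneric.countable_cos_eq_zero`,
`CharData.IsSolution.integral_comp_x_mul_ξ`).

Taking the supremum over `φ` gives the `L¹` bound, with constant `1`; a cutoff extends the second
bound to all `f`. The `L¹` bound shows that `distStar` separates points. Its symmetry comes from
the reversal of paths, and the triangle inequality from the concatenation of chains.
-/

namespace Novikov
open MeasureTheory Set Filter Topology

/-! ### Integrals depending on a parameter -/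

/-- A family of monotone surjections of the line that depends continuously on `θ ∈ [0, 1]` tends to
infinity uniformly in `θ`. -/
theorem exists_forall_le_of_monotone {X : ℝ × ℝ → ℝ}
    (hc : ContinuousOn X (univ ×ˢ Icc 0 1))
    (hm : ∀ θ ∈ Icc (0 : ℝ) 1, Monotone fun Y => X (Y, θ))
    (hs : ∀ θ ∈ Icc (0 : ℝ) 1, Function.Surjective fun Y => X (Y, θ)) (R : ℝ) :
    ∃ B, ∀ θ ∈ Icc (0 : ℝ) 1, ∀ Y, B ≤ Y → R ≤ X (Y, θ) := by
  refine isCompact_Icc.induction_on (p := fun s => ∃ B, ∀ θ ∈ s, ∀ Y, B ≤ Y → R ≤ X (Y, θ))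
    ⟨0, by simp⟩ ?_ ?_ ?_
  · rintro s t hst ⟨B, hB⟩
    exact ⟨B, fun θ hθ => hB θ (hst hθ)⟩
  · rintro s t ⟨B, hB⟩ ⟨B', hB'⟩
    refine ⟨max B B', ?_⟩
    rintro θ (h | h) Y hY
    · exact hB θ h Y ((le_max_left _ _).trans hY)
    · exact hB' θ h Y ((le_max_right _ _).trans hY)
  · intro θ hθ
    obtain ⟨B, hB⟩ := hs θ hθ (R + 1)
    have hcB : ContinuousOn (fun η => X (B, η)) (Icc 0 1) :=
      hc.comp (by fun_prop) fun η hη => ⟨mem_univ _, hη⟩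
    have hev : ∀ᶠ η in 𝓝[Icc 0 1] θ, R < X (B, η) :=
      (hcB θ hθ).eventually_const_lt (by simp only at hB; linarith)
    refine ⟨{η | R < X (B, η)} ∩ Icc 0 1, inter_mem hev self_mem_nhdsWithin, B, ?_⟩
    rintro η ⟨hη, hη'⟩ Y hY
    exact hη.le.trans (hm η hη' hY)

theorem exists_forall_ge_of_monotone {X : ℝ × ℝ → ℝ}
    (hc : ContinuousOn X (univ ×ˢ Icc 0 1))
    (hm : ∀ θ ∈ Icc (0 : ℝ) 1, Monotone fun Y => X (Y, θ))
    (hs : ∀ θ ∈ Icc (0 : ℝ) 1, Function.Surjective fun Y => X (Y, θ)) (R : ℝ) :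
    ∃ A, ∀ θ ∈ Icc (0 : ℝ) 1, ∀ Y, Y ≤ A → X (Y, θ) ≤ R := by
  obtain ⟨B, hB⟩ := exists_forall_le_of_monotone (X := fun p => -X (-p.1, p.2))
    (hc.comp (by fun_prop) fun p hp => ⟨mem_univ _, hp.2⟩).neg
    (fun θ hθ Y Z hYZ => neg_le_neg (hm θ hθ (neg_le_neg hYZ)))
    (fun θ hθ r => by
      obtain ⟨Y, hY⟩ := hs θ hθ (-r)
      exact ⟨-Y, by simp only at hY; simp [hY]⟩) (-R)
  refine ⟨-B, fun θ hθ Y hY => ?_⟩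
  have := hB θ hθ (-Y) (by linarith)
  simp only [neg_neg] at this
  linarith

/-- The speed bound `N` need not be measurable; if its integral is finite, it makes `F'` integrable,
so that the fundamental theorem of calculus applies in spite of the exceptional set. -/
theorem enorm_sub_le_lintegral {F F' : ℝ → ℝ} {S : Set ℝ} (hS : S.Countable)
    (hF : ContinuousOn F (Icc 0 1)) (hF' : ∀ θ ∈ Ioo 0 1 \ S, HasDerivAt F (F' θ) θ)
    {N : ℝ → ℝ≥0∞} (hN : ∀ θ ∈ Ioo 0 1 \ S, ‖F' θ‖ₑ ≤ N θ) :
    ‖F 1 - F 0‖ₑ ≤ ∫⁻ θ in Ioo (0 : ℝ) 1, N θ := by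
  rcases eq_or_ne (∫⁻ θ in Ioo (0 : ℝ) 1, N θ) ∞ with h | h
  · simp [h]
  have hae : ∀ᵐ θ ∂volume.restrict (Ioo (0 : ℝ) 1), ‖deriv F θ‖ₑ ≤ N θ := by
    rw [ae_restrict_iff' measurableSet_Ioo]
    filter_upwards [hS.ae_notMem volume] with θ hθ hθ'
    rw [(hF' θ ⟨hθ', hθ⟩).deriv]
    exact hN θ ⟨hθ', hθ⟩
  have hle := lintegral_mono_ae hae
  have hint : IntervalIntegrable (deriv F) volume 0 1 := by
    rw [intervalIntegrable_iff_integrableOn_Ioo_of_le zero_le_one]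
    exact ⟨(measurable_deriv F).aestronglyMeasurable,
      hle.trans_lt (lt_top_iff_ne_top.2 h)⟩
  have := MeasureTheory.integral_eq_of_hasDerivAt_off_countable_of_le F (deriv F) zero_le_one hS
    hF (fun θ hθ => (hF' θ hθ).differentiableAt.hasDerivAt) hint
  rw [← this, intervalIntegral.integral_of_le zero_le_one, integral_Ioc_eq_integral_Ioo]
  exact (enorm_integral_le_lintegral_enorm _).trans hle

theorem continuousOn_parametric_integral {G : ℝ × ℝ → ℝ} (hG : ContinuousOn G (univ ×ˢ Icc 0 1))
    (A B : ℝ) : ContinuousOn (fun θ => ∫ Y in A..B, G (Y, θ)) (Icc 0 1) := by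
  have hc : Continuous fun p : ℝ × ℝ => G (p.2, projIcc (0 : ℝ) 1 zero_le_one p.1) :=
    hG.comp_continuous (by fun_prop) fun p => ⟨mem_univ _, (projIcc (0 : ℝ) 1 zero_le_one p.1).2⟩
  have := intervalIntegral.continuous_parametric_intervalIntegral_of_continuous'
    (μ := volume) (f := fun θ Y => G (Y, projIcc (0 : ℝ) 1 zero_le_one θ)) hc A B
  refine this.continuousOn.congr fun θ hθ => ?_
  simp [projIcc_of_mem zero_le_one hθ]

theorem hasDerivAt_slice_fst {E : Type*} [NormedAddCommGroup E] [NormedSpace ℝ E]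
    {G : ℝ × ℝ → E} {Y θ : ℝ} (h : DifferentiableAt ℝ G (Y, θ)) :
    HasDerivAt (fun Z => G (Z, θ)) (fderiv ℝ G (Y, θ) (1, 0)) Y :=
  HasFDerivAt.comp_hasDerivAt (x := Y) (f := fun Z => (Z, θ)) h.hasFDerivAt
    ((hasDerivAt_id _).prodMk (hasDerivAt_const _ _))

theorem hasDerivAt_slice_snd {E : Type*} [NormedAddCommGroup E] [NormedSpace ℝ E]
    {G : ℝ × ℝ → E} {Y θ : ℝ} (h : DifferentiableAt ℝ G (Y, θ)) :
    HasDerivAt (fun η => G (Y, η)) (fderiv ℝ G (Y, θ) (0, 1)) θ :=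
  HasFDerivAt.comp_hasDerivAt (x := θ) (f := fun η => (Y, η)) h.hasFDerivAt
    ((hasDerivAt_const _ _).prodMk (hasDerivAt_id _))

theorem hasDerivAt_integral_param {G : ℝ × ℝ → ℝ} {O : Set ℝ} (hO : IsOpen O)
    (hG : ContDiffOn ℝ 1 G (univ ×ˢ O)) (A B : ℝ) {θ : ℝ} (hθ : θ ∈ O) :
    HasDerivAt (fun η => ∫ Y in A..B, G (Y, η)) (∫ Y in A..B, fderiv ℝ G (Y, θ) (0, 1)) θ := by
  have hOp := isOpen_univ.prod (X := ℝ) hO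
  have hcont : ContinuousOn (fun p => fderiv ℝ G p (0, 1)) (univ ×ˢ O) :=
    (hG.continuousOn_fderiv_of_isOpen hOp le_rfl).clm_apply continuousOn_const
  have hslice : ∀ η ∈ O, ∀ {F : ℝ × ℝ → ℝ}, ContinuousOn F (univ ×ˢ O) →
      Continuous fun Y => F (Y, η) := fun η hη F hF =>
    hF.comp_continuous (by fun_prop) fun Y => ⟨mem_univ _, hη⟩
  obtain ⟨ε, hε, hball⟩ := Metric.nhds_basis_closedBall.mem_iff.1 (hO.mem_nhds hθ)
  obtain ⟨C, hC⟩ := ((isCompact_uIcc (a := A) (b := B)).prod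
    (isCompact_closedBall θ ε)).exists_bound_of_continuousOn
    (hcont.mono fun p hp => ⟨mem_univ _, hball hp.2⟩)
  refine (intervalIntegral.hasDerivAt_integral_of_dominated_loc_of_deriv_le
    (F := fun η Y => G (Y, η)) (F' := fun η Y => fderiv ℝ G (Y, η) (0, 1)) (bound := fun _ => C)
    (Metric.closedBall_mem_nhds θ hε) ?_ ?_ ?_ ?_ ?_ ?_).2
  · filter_upwards [hO.mem_nhds hθ] with η hη
    exact (hslice η hη hG.continuousOn).aestronglyMeasurable
  · exact (hslice θ hθ hG.continuousOn).intervalIntegrable _ _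
  · exact (hslice θ hθ hcont).aestronglyMeasurable
  · exact ae_of_all _ fun Y hY η hη => hC (Y, η) ⟨uIoc_subset_uIcc hY, hη⟩
  · exact intervalIntegrable_const
  · refine ae_of_all _ fun Y _ η hη => ?_
    exact hasDerivAt_slice_snd
      ((hG.contDiffAt (hOp.mem_nhds ⟨mem_univ _, hball hη⟩)).differentiableAt one_ne_zero)

/-- If `∂_θ G + ∂_Y H = R` and `H` vanishes at the ends of `[A, B]`, then `∫ G dY` over `[A, B]`
varies at a speed of at most `∫ |R| dY`. Points of the plane are written `(Y, θ)`. -/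
theorem enorm_integral_sub_le_of_balance_law {S : Set ℝ} (hS : S.Finite) {G H R : ℝ × ℝ → ℝ}
    {A B : ℝ} (hGc : ContinuousOn G (univ ×ˢ Icc 0 1))
    (hG : ContDiffOn ℝ 1 G (univ ×ˢ (Ioo 0 1 \ S)))
    (hH : ContDiffOn ℝ 1 H (univ ×ˢ (Ioo 0 1 \ S)))
    (hHA : ∀ θ ∈ Ioo 0 1 \ S, H (A, θ) = 0) (hHB : ∀ θ ∈ Ioo 0 1 \ S, H (B, θ) = 0)
    (hR : ∀ θ ∈ Ioo 0 1 \ S, ∀ Y, ∃ a b, HasDerivAt (fun η => G (Y, η)) a θ ∧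
      HasDerivAt (fun Z => H (Z, θ)) b Y ∧ a + b = R (Y, θ))
    {N : ℝ → ℝ≥0∞} (hN : ∀ θ ∈ Ioo 0 1 \ S, ∫⁻ Y, ‖R (Y, θ)‖ₑ ≤ N θ) :
    ‖(∫ Y in A..B, G (Y, 1)) - ∫ Y in A..B, G (Y, 0)‖ₑ ≤ ∫⁻ θ in Ioo (0 : ℝ) 1, N θ := by
  have hO : IsOpen (Ioo 0 1 \ S) := isOpen_Ioo.sdiff hS.isClosed
  have hOp := isOpen_univ.prod (X := ℝ) hO
  have hslice : ∀ η ∈ Ioo 0 1 \ S, ∀ {F : ℝ × ℝ → ℝ},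
      ContinuousOn F (univ ×ˢ (Ioo 0 1 \ S)) → Continuous fun Y => F (Y, η) := fun η hη F hF =>
    hF.comp_continuous (by fun_prop) fun Y => ⟨mem_univ _, hη⟩
  refine enorm_sub_le_lintegral (F := fun θ => ∫ Y in A..B, G (Y, θ)) hS.countable
    (continuousOn_parametric_integral hGc A B)
    (fun θ hθ => hasDerivAt_integral_param hO hG A B hθ) fun θ hθ => ?_
  have hdiff : ∀ {F : ℝ × ℝ → ℝ}, ContDiffOn ℝ 1 F (univ ×ˢ (Ioo 0 1 \ S)) → ∀ Y,
      DifferentiableAt ℝ F (Y, θ) := fun hF Y =>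
    (hF.contDiffAt (hOp.mem_nhds ⟨mem_univ _, hθ⟩)).differentiableAt one_ne_zero
  have hGi : IntervalIntegrable (fun Y => fderiv ℝ G (Y, θ) (0, 1)) volume A B :=
    (hslice θ hθ ((hG.continuousOn_fderiv_of_isOpen hOp le_rfl).clm_apply
      continuousOn_const)).intervalIntegrable _ _
  have hHi : IntervalIntegrable (fun Y => fderiv ℝ H (Y, θ) (1, 0)) volume A B :=
    (hslice θ hθ ((hH.continuousOn_fderiv_of_isOpen hOp le_rfl).clm_apply
      continuousOn_const)).intervalIntegrable _ _
  have hzero : ∫ Y in A..B, fderiv ℝ H (Y, θ) (1, 0) = 0 := by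
    rw [intervalIntegral.integral_eq_sub_of_hasDerivAt
      (fun Y _ => hasDerivAt_slice_fst (hdiff hH Y)) hHi]
    simp [hHA θ hθ, hHB θ hθ]
  have hsum : ∫ Y in A..B, fderiv ℝ G (Y, θ) (0, 1) = ∫ Y in A..B, R (Y, θ) := by
    have h := intervalIntegral.integral_add hGi hHi
    rw [hzero, add_zero] at h
    rw [← h]
    congr 1 with Y
    obtain ⟨a, b, ha, hb, hab⟩ := hR θ hθ Y
    rw [← hab, ha.unique (hasDerivAt_slice_snd (hdiff hG Y)),
      hb.unique (hasDerivAt_slice_fst (hdiff hH Y))]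
  rw [hsum, intervalIntegral.intervalIntegral_eq_integral_uIoc, enorm_smul]
  have h1 : ‖(if A ≤ B then 1 else -1 : ℝ)‖ₑ = 1 := by split_ifs <;> simp
  rw [h1, one_mul]
  exact (enorm_integral_le_lintegral_enorm _).trans
    ((lintegral_mono' Measure.restrict_le_self le_rfl).trans (hN θ hθ))

/-- Symmetry of the mixed second derivatives, `∂_Y (X_θ) = ∂_θ m` where `m = X_Y`. -/
theorem hasDerivAt_fderiv_slice {X m : ℝ × ℝ → ℝ} {V : Set (ℝ × ℝ)} (hV : IsOpen V)
    (hX : ContDiffOn ℝ 2 X V) (hm : ∀ p ∈ V, fderiv ℝ X p (1, 0) = m p) {Y θ : ℝ}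
    (hp : (Y, θ) ∈ V) :
    HasDerivAt (fun Z => fderiv ℝ X (Z, θ) (0, 1)) (fderiv ℝ m (Y, θ) (0, 1)) Y := by
  have hXp : ContDiffAt ℝ 2 X (Y, θ) := hX.contDiffAt (hV.mem_nhds hp)
  have hd : DifferentiableAt ℝ (fderiv ℝ X) (Y, θ) :=
    (hXp.fderiv_right (m := 1) (by norm_num)).differentiableAt one_ne_zero
  have hsymm : IsSymmSndFDerivAt ℝ X (Y, θ) := hXp.isSymmSndFDerivAt (by simp)
  have h1 : m =ᶠ[𝓝 (Y, θ)] fun p => fderiv ℝ X p (1, 0) := by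
    filter_upwards [hV.mem_nhds hp] with p hp using (hm p hp).symm
  have h2 : fderiv ℝ m (Y, θ) (0, 1) = fderiv ℝ (fderiv ℝ X) (Y, θ) (0, 1) (1, 0) := by
    rw [h1.fderiv_eq, fderiv_clm_apply hd (differentiableAt_const _)]
    simp
  rw [h2, hsymm.eq]
  have := (hasDerivAt_slice_fst hd).clm_apply (hasDerivAt_const Y ((0, 1) : ℝ × ℝ))
  simpa using this

/-! ### The characteristic map at a fixed time -/

namespace CharData

/-- The derivative `x_Y = ξ cos⁴(α/2)`, by its formula in the unknowns of the system. -/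
noncomputable def xY (S : CharData) (t Y : ℝ) : ℝ := S.ξ t Y * Real.cos (S.α t Y / 2) ^ 4

/-- The derivative `u_Y = ½ ξ sin α cos²(α/2)`, by its formula in the unknowns of the system. -/
noncomputable def uY (S : CharData) (t Y : ℝ) : ℝ :=
  1 / 2 * S.ξ t Y * Real.sin (S.α t Y) * Real.cos (S.α t Y / 2) ^ 2

theorem IsSolution.monotone_x {T : ℝ} {S : CharData} (h : S.IsSolution T) {t : ℝ}
    (ht : t ∈ Icc 0 T) : Monotone (S.x t) :=
  monotone_of_hasDerivAt_nonneg (h.x_Y t ht) fun Y =>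
    mul_nonneg (h.ξ_pos t ht Y).le (by positivity)

end CharData

theorem MemH1W14.continuous {u : ℝ → ℝ} (h : MemH1W14 u) : Continuous u := by
  refine continuous_iff_continuousAt.2 fun x => ?_
  exact (h.absCont (x - 1) (x + 1)).continuousOn.continuousAt
    (by rw [uIcc_of_le (by linarith)]; exact Icc_mem_nhds (by linarith) (by linarith))

theorem integral_eq_intervalIntegral_of_zero {g : ℝ → ℝ} {R a b : ℝ}
    (hg : ∀ x, R ≤ ‖x‖ → g x = 0) (ha : a ≤ -R) (hb : R ≤ b) :
    ∫ x in a..b, g x = ∫ x, g x := by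
  refine intervalIntegral.integral_eq_integral_of_support_subset fun x hx => ?_
  have : |x| < R := by
    by_contra! h
    exact hx (hg x h)
  rw [abs_lt] at this
  exact ⟨by linarith, by linarith⟩

/-- Where `x_Y` vanishes, `x(·)` may fail to be injective; the substitution does not need it. -/
theorem integral_comp_x_mul_u {T t : ℝ} {S : CharData} (h : S.IsSolution T) (ht : t ∈ Icc 0 T)
    (hc : Continuous (S.xY t)) {φ : ℝ → ℝ} (hφ : Continuous φ) {R A B : ℝ}
    (hφR : ∀ x, R ≤ ‖x‖ → φ x = 0) (hA : S.x t A ≤ -R) (hB : R ≤ S.x t B) :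
    ∫ Y in A..B, φ (S.x t Y) * S.u t Y * S.xY t Y = ∫ x, φ x * S.U t x := by
  have := intervalIntegral.integral_comp_mul_deriv (a := A) (b := B) (f := S.x t) (f' := S.xY t)
    (g := fun x => φ x * S.U t x) (fun Y _ => h.x_Y t ht Y) hc.continuousOn
    (hφ.mul (h.memH1W14 t ht).continuous)
  rw [integral_eq_intervalIntegral_of_zero (R := R) (fun x hx => by simp [hφR x hx]) hA hB] at this
  rw [← this]
  congr 1 with Y
  simp [h.graph t ht Y]

/-! ### Change of integrals along a path -/

section Path

variable {T t : ℝ} {B : Finset ℝ} {S : ℝ → CharData}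

/-- The preimages of `(-R, R)` under all `x^θ(·)` lie in one bounded interval. -/
theorem IsPiecewiseRegular.exists_bounds (hp : IsPiecewiseRegular T B S) (ht : t ∈ Icc 0 T)
    (R : ℝ) : ∃ A' B', ∀ θ ∈ Icc (0 : ℝ) 1,
      (∀ Y ≤ A', (S θ).x t Y ≤ -R) ∧ ∀ Y, B' ≤ Y → R ≤ (S θ).x t Y := by
  have hc : ContinuousOn (fun p : ℝ × ℝ => (S p.2).x t p.1) (univ ×ˢ Icc 0 1) :=
    (hp.cont t ht).fst
  obtain ⟨A', hA⟩ := exists_forall_ge_of_monotone hc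
    (fun θ hθ => (hp.solution θ hθ).monotone_x ht) (fun θ hθ => (hp.solution θ hθ).x_surj t ht) (-R)
  obtain ⟨B', hB⟩ := exists_forall_le_of_monotone hc
    (fun θ hθ => (hp.solution θ hθ).monotone_x ht) (fun θ hθ => (hp.solution θ hθ).x_surj t ht) R
  exact ⟨A', B', fun θ hθ => ⟨hA θ hθ, hB θ hθ⟩⟩

theorem IsPiecewiseRegular.continuousOn_xY (hp : IsPiecewiseRegular T B S) (ht : t ∈ Icc 0 T) :
    ContinuousOn (fun p : ℝ × ℝ => (S p.2).xY t p.1) (univ ×ˢ Icc 0 1) := by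
  have h := hp.cont t ht
  have hα := h.snd.snd.fst
  have hξ := h.snd.snd.snd
  exact hξ.mul ((Real.continuous_cos.comp_continuousOn (hα.div_const 2)).pow 4)

theorem continuous_slice {F : ℝ × ℝ → ℝ} {O : Set ℝ} (hF : ContinuousOn F (univ ×ˢ O)) {θ : ℝ}
    (hθ : θ ∈ O) : Continuous fun Y => F (Y, θ) :=
  hF.comp_continuous (by fun_prop) fun _ => ⟨mem_univ _, hθ⟩

theorem continuous_fderiv_slice {F : ℝ × ℝ → ℝ} {O : Set ℝ} (hO : IsOpen O)
    (hF : ContDiffOn ℝ ∞ F (univ ×ˢ O)) {θ : ℝ} (hθ : θ ∈ O) (v : ℝ × ℝ) :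
    Continuous fun Y => fderiv ℝ F (Y, θ) v :=
  continuous_slice ((hF.continuousOn_fderiv_of_isOpen (isOpen_univ.prod hO) (by simp)).clm_apply
    continuousOn_const) hθ

theorem lintegral_enorm_le_add {R J K : ℝ → ℝ} (hJ : Continuous J)
    (h : ∀ Y, |R Y| ≤ |J Y| + |K Y|) :
    ∫⁻ Y, ‖R Y‖ₑ ≤ (∫⁻ Y, ENNReal.ofReal |J Y|) + ∫⁻ Y, ENNReal.ofReal |K Y| := by
  rw [← lintegral_add_left (by fun_prop)]
  refine lintegral_mono fun Y => ?_
  rw [← ENNReal.ofReal_add (abs_nonneg _) (abs_nonneg _), Real.enorm_eq_ofReal_abs]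
  exact ENNReal.ofReal_le_ofReal (h Y)

/-- Along a path, `∫ φ u dx` changes by at most the length, whatever the shift `q`. -/
theorem IsPiecewiseRegular.enorm_integral_mul_sub_le (hp : IsPiecewiseRegular T B S)
    (ht : t ∈ Icc 0 T) {q : ℝ → ℝ → ℝ}
    (hq : ContDiffOn ℝ ∞ (fun p : ℝ × ℝ => q p.2 p.1) (univ ×ˢ (Ioo 0 1 \ (B : Set ℝ))))
    {φ : ℝ → ℝ} (hφ : ContDiff ℝ 1 φ) (hφc : HasCompactSupport φ) (hφ1 : ∀ x, |φ x| ≤ 1) :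
    ‖(∫ x, φ x * (S 1).U t x) - ∫ x, φ x * (S 0).U t x‖ₑ
      ≤ ∫⁻ θ in Ioo (0 : ℝ) 1, tangentNorm S t θ (q θ) := by
  obtain ⟨R, -, hR⟩ := hφc.exists_pos_le_norm
  obtain ⟨a, b, hab⟩ := hp.exists_bounds ht R
  have hφab : ∀ θ ∈ Icc (0 : ℝ) 1, φ ((S θ).x t a) = 0 ∧ φ ((S θ).x t b) = 0 := fun θ hθ =>
    ⟨hR _ (by
      have := (hab θ hθ).1 a le_rfl
      rw [Real.norm_eq_abs]; exact (by linarith : R ≤ -(S θ).x t a).trans (neg_le_abs _)),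
    hR _ (((hab θ hθ).2 b le_rfl).trans (le_abs_self _))⟩
  have hmc := hp.continuousOn_xY ht
  have hend : ∀ θ ∈ Icc (0 : ℝ) 1, ∫ x, φ x * (S θ).U t x
      = ∫ Y in a..b, φ ((S θ).x t Y) * (S θ).u t Y * (S θ).xY t Y := fun θ hθ =>
    (integral_comp_x_mul_u (hp.solution θ hθ) ht (continuous_slice hmc hθ) hφ.continuous hR
      ((hab θ hθ).1 a le_rfl) ((hab θ hθ).2 b le_rfl)).symm
  rw [hend 1 (by simp), hend 0 (by simp)]
  set O := Ioo (0 : ℝ) 1 \ (B : Set ℝ)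
  have hO : IsOpen O := isOpen_Ioo.sdiff B.finite_toSet.isClosed
  have hOp : IsOpen ((univ : Set ℝ) ×ˢ O) := isOpen_univ.prod hO
  have hOI : ∀ θ ∈ O, θ ∈ Icc (0 : ℝ) 1 := fun θ hθ => Ioo_subset_Icc_self hθ.1
  let X : ℝ × ℝ → ℝ := fun p => (S p.2).x t p.1
  let U : ℝ × ℝ → ℝ := fun p => (S p.2).u t p.1
  let m : ℝ × ℝ → ℝ := fun p => (S p.2).xY t p.1
  have hX : ContDiffOn ℝ ∞ X (univ ×ˢ O) := (hp.smooth t ht).fst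
  have hU : ContDiffOn ℝ ∞ U (univ ×ˢ O) := (hp.smooth t ht).snd.fst
  have hα : ContDiffOn ℝ ∞ (fun p : ℝ × ℝ => (S p.2).α t p.1) (univ ×ˢ O) :=
    (hp.smooth t ht).snd.snd.fst
  have hξ : ContDiffOn ℝ ∞ (fun p : ℝ × ℝ => (S p.2).ξ t p.1) (univ ×ˢ O) :=
    (hp.smooth t ht).snd.snd.snd
  have hm : ContDiffOn ℝ ∞ m (univ ×ˢ O) :=
    hξ.mul ((Real.contDiff_cos.comp_contDiffOn (hα.div_const 2)).pow 4)
  have hdiff : ∀ {F : ℝ × ℝ → ℝ}, ContDiffOn ℝ ∞ F (univ ×ˢ O) → ∀ θ ∈ O, ∀ Y,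
      DifferentiableAt ℝ F (Y, θ) := fun hF θ hθ Y =>
    (hF.contDiffAt (hOp.mem_nhds ⟨mem_univ _, hθ⟩)).differentiableAt (by simp)
  have hXY : ∀ p ∈ (univ : Set ℝ) ×ˢ O, fderiv ℝ X p (1, 0) = m p := by
    rintro ⟨Y, θ⟩ ⟨-, hθ⟩
    exact (hasDerivAt_slice_fst (hdiff hX θ hθ Y)).unique
      ((hp.solution θ (hOI θ hθ)).x_Y t ht Y)
  refine enorm_integral_sub_le_of_balance_law B.finite_toSet
    (G := fun p => φ (X p) * U p * m p) (H := fun p => -(φ (X p) * U p * fderiv ℝ X p (0, 1)))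
    (R := fun p => φ (X p) * (fderiv ℝ U p (0, 1) * m p
      - (S p.2).uY t p.1 * fderiv ℝ X p (0, 1)))
    ?_ ?_ ?_ ?_ ?_ ?_ ?_
  · exact ((hφ.continuous.comp_continuousOn (hp.cont t ht).fst).mul (hp.cont t ht).snd.fst).mul hmc
  · exact ((hφ.comp_contDiffOn (hX.of_le (by simp))).mul (hU.of_le (by simp))).mul
      (hm.of_le (by simp))
  · refine (((hφ.comp_contDiffOn (hX.of_le (by simp))).mul (hU.of_le (by simp))).mul ?_).neg
    exact (hX.fderiv_of_isOpen (m := 1) hOp (by norm_cast)).clm_apply contDiffOn_const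
  · intro θ hθ
    simp [X, (hφab θ (hOI θ hθ)).1]
  · intro θ hθ
    simp [X, (hφab θ (hOI θ hθ)).2]
  · intro θ hθ Y
    have hφd : HasDerivAt φ (deriv φ (X (Y, θ))) (X (Y, θ)) :=
      (hφ.differentiable one_ne_zero _).hasDerivAt
    have h1 := ((hφd.comp θ (hasDerivAt_slice_snd (hdiff hX θ hθ Y))).mul
      (hasDerivAt_slice_snd (hdiff hU θ hθ Y))).mul (hasDerivAt_slice_snd (hdiff hm θ hθ Y))
    have h2 := (((hφd.comp Y ((hp.solution θ (hOI θ hθ)).x_Y t ht Y)).mul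
      ((hp.solution θ (hOI θ hθ)).u_Y t ht Y)).mul
      (hasDerivAt_fderiv_slice hOp (hX.of_le (by norm_cast)) hXY ⟨mem_univ Y, hθ⟩)).neg
    refine ⟨_, _, h1, h2, ?_⟩
    simp only [X, U, m, CharData.uY, CharData.xY, Function.comp, Pi.mul_apply]
    ring
  · intro θ hθ
    have hdx : ∀ Y, deriv (fun η => (S η).x t Y) θ = fderiv ℝ X (Y, θ) (0, 1) := fun Y =>
      (hasDerivAt_slice_snd (hdiff hX θ hθ Y)).deriv
    have hdu : ∀ Y, deriv (fun η => (S η).u t Y) θ = fderiv ℝ U (Y, θ) (0, 1) := fun Y =>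
      (hasDerivAt_slice_snd (hdiff hU θ hθ Y)).deriv
    have hsol := hp.solution θ (hOI θ hθ)
    have hdx' : ∀ Y, deriv (fun Z => (S θ).x t Z) Y = m (Y, θ) := fun Y =>
      (hsol.x_Y t ht Y).deriv
    have hdu' : ∀ Y, deriv (fun Z => (S θ).u t Z) Y = (S θ).uY t Y := fun Y =>
      (hsol.u_Y t ht Y).deriv
    refine le_trans ?_ (le_self_add.trans le_self_add :
      _ ≤ tangentNorm S t θ (q θ))
    simp only [hdx, hdu, hdx', hdu']
    refine lintegral_enorm_le_add ?_ fun Y => ?_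
    · have h1 := continuous_fderiv_slice hO hX hθ (0, 1)
      have h2 : Continuous fun Y => m (Y, θ) := continuous_slice hm.continuousOn hθ
      have h3 : Continuous fun Y => q θ Y := continuous_slice hq.continuousOn hθ
      have h4 : Continuous fun Y => (S θ).ξ t Y := continuous_slice hξ.continuousOn hθ
      exact (h1.add (h2.mul h3)).mul h4
    · have hξ0 := hsol.ξ_pos t ht Y
      have hφY := hφ1 (X (Y, θ))
      have hm1 : |m (Y, θ)| ≤ (S θ).ξ t Y := by
        simp only [m, CharData.xY]
        rw [abs_mul, abs_of_pos hξ0, abs_pow]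
        exact mul_le_of_le_one_right hξ0.le (pow_le_one₀ (abs_nonneg _) (Real.abs_cos_le_one _))
      have hu1 : |(S θ).uY t Y| ≤ (S θ).ξ t Y := by
        have hs := Real.abs_sin_le_one ((S θ).α t Y)
        have hc : |Real.cos ((S θ).α t Y / 2)| ^ 2 ≤ 1 :=
          pow_le_one₀ (abs_nonneg _) (Real.abs_cos_le_one _)
        simp only [CharData.uY]
        rw [abs_mul, abs_mul, abs_mul, abs_pow, abs_of_pos hξ0,
          abs_of_pos (by norm_num : (0 : ℝ) < 1 / 2)]
        calc _ ≤ 1 / 2 * (S θ).ξ t Y * 1 * 1 := by gcongr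
          _ ≤ _ := by linarith
      -- The shift `q` cancels in the Jacobian `u_θ x_Y - u_Y x_θ`.
      have hid : fderiv ℝ U (Y, θ) (0, 1) * m (Y, θ) - (S θ).uY t Y * fderiv ℝ X (Y, θ) (0, 1)
          = (fderiv ℝ U (Y, θ) (0, 1) + (S θ).uY t Y * q θ Y) * m (Y, θ)
            - (fderiv ℝ X (Y, θ) (0, 1) + m (Y, θ) * q θ Y) * (S θ).uY t Y := by ring
      simp only [hid]
      rw [abs_mul]
      refine (mul_le_of_le_one_left (abs_nonneg _) hφY).trans ((abs_sub _ _).trans ?_)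
      rw [add_comm, abs_mul, abs_mul, abs_mul, abs_mul, abs_of_pos hξ0]
      gcongr

/-- Along a path, the integral of `f` against the measure `ξ dY` changes by at most the length. Here
`ξ dY` may have a singular part at intermediate parameters. -/
theorem IsPiecewiseRegular.enorm_integral_measure_sub_le (hp : IsPiecewiseRegular T B S)
    (ht : t ∈ Icc 0 T) {q : ℝ → ℝ → ℝ}
    (hq : ContDiffOn ℝ ∞ (fun p : ℝ × ℝ => q p.2 p.1) (univ ×ˢ (Ioo 0 1 \ (B : Set ℝ))))
    {f : ℝ → ℝ} (hf : ContDiff ℝ 1 f) {a b : ℝ}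
    (hfa : ∀ θ ∈ Icc (0 : ℝ) 1, f ((S θ).x t a) = 0)
    (hfb : ∀ θ ∈ Icc (0 : ℝ) 1, f ((S θ).x t b) = 0)
    (hf1 : ∀ x, |f x| ≤ 1) (hf' : ∀ x, |deriv f x| ≤ 1) :
    ‖(∫ Y in a..b, f ((S 1).x t Y) * (S 1).ξ t Y) - ∫ Y in a..b, f ((S 0).x t Y) * (S 0).ξ t Y‖ₑ
      ≤ ∫⁻ θ in Ioo (0 : ℝ) 1, tangentNorm S t θ (q θ) := by
  set O := Ioo (0 : ℝ) 1 \ (B : Set ℝ)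
  have hO : IsOpen O := isOpen_Ioo.sdiff B.finite_toSet.isClosed
  have hOp : IsOpen ((univ : Set ℝ) ×ˢ O) := isOpen_univ.prod hO
  have hOI : ∀ θ ∈ O, θ ∈ Icc (0 : ℝ) 1 := fun θ hθ => Ioo_subset_Icc_self hθ.1
  let X : ℝ × ℝ → ℝ := fun p => (S p.2).x t p.1
  let Ξ : ℝ × ℝ → ℝ := fun p => (S p.2).ξ t p.1
  let Q : ℝ × ℝ → ℝ := fun p => q p.2 p.1
  have hX : ContDiffOn ℝ ∞ X (univ ×ˢ O) := (hp.smooth t ht).fst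
  have hξ : ContDiffOn ℝ ∞ Ξ (univ ×ˢ O) := (hp.smooth t ht).snd.snd.snd
  have hQ : ContDiffOn ℝ ∞ Q (univ ×ˢ O) := hq
  have hdiff : ∀ {F : ℝ × ℝ → ℝ}, ContDiffOn ℝ ∞ F (univ ×ˢ O) → ∀ θ ∈ O, ∀ Y,
      DifferentiableAt ℝ F (Y, θ) := fun hF θ hθ Y =>
    (hF.contDiffAt (hOp.mem_nhds ⟨mem_univ _, hθ⟩)).differentiableAt (by simp)
  refine enorm_integral_sub_le_of_balance_law B.finite_toSet
    (G := fun p => f (X p) * Ξ p) (H := fun p => Q p * (f (X p) * Ξ p))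
    (R := fun p => deriv f (X p) * ((fderiv ℝ X p (0, 1) + fderiv ℝ X p (1, 0) * Q p) * Ξ p)
      + f (X p) * (fderiv ℝ Ξ p (0, 1) + fderiv ℝ Ξ p (1, 0) * Q p + Ξ p * fderiv ℝ Q p (1, 0)))
    ?_ ?_ ?_ ?_ ?_ ?_ ?_
  · exact (hf.continuous.comp_continuousOn (hp.cont t ht).fst).mul (hp.cont t ht).snd.snd.snd
  · exact (hf.comp_contDiffOn (hX.of_le (by simp))).mul (hξ.of_le (by simp))
  · exact (hQ.of_le (by simp)).mul
      ((hf.comp_contDiffOn (hX.of_le (by simp))).mul (hξ.of_le (by simp)))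
  · intro θ hθ
    simp [X, hfa θ (hOI θ hθ)]
  · intro θ hθ
    simp [X, hfb θ (hOI θ hθ)]
  · intro θ hθ Y
    have hfd : HasDerivAt f (deriv f (X (Y, θ))) (X (Y, θ)) :=
      (hf.differentiable one_ne_zero _).hasDerivAt
    have h1 := (hfd.comp θ (hasDerivAt_slice_snd (hdiff hX θ hθ Y))).mul
      (hasDerivAt_slice_snd (hdiff hξ θ hθ Y))
    have h2 := (hasDerivAt_slice_fst (hdiff hQ θ hθ Y)).mul
      ((hfd.comp Y (hasDerivAt_slice_fst (hdiff hX θ hθ Y))).mul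
      (hasDerivAt_slice_fst (hdiff hξ θ hθ Y)))
    refine ⟨_, _, h1, h2, ?_⟩
    simp only [Function.comp, Pi.mul_apply]
    ring
  · intro θ hθ
    have hdx : ∀ Y, deriv (fun η => (S η).x t Y) θ = fderiv ℝ X (Y, θ) (0, 1) := fun Y =>
      (hasDerivAt_slice_snd (hdiff hX θ hθ Y)).deriv
    have hdx' : ∀ Y, deriv (fun Z => (S θ).x t Z) Y = fderiv ℝ X (Y, θ) (1, 0) := fun Y =>
      (hasDerivAt_slice_fst (hdiff hX θ hθ Y)).deriv
    have hdξ : ∀ Y, deriv (fun η => (S η).ξ t Y) θ = fderiv ℝ Ξ (Y, θ) (0, 1) := fun Y =>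
      (hasDerivAt_slice_snd (hdiff hξ θ hθ Y)).deriv
    have hdξ' : ∀ Y, deriv (fun Z => (S θ).ξ t Z) Y = fderiv ℝ Ξ (Y, θ) (1, 0) := fun Y =>
      (hasDerivAt_slice_fst (hdiff hξ θ hθ Y)).deriv
    have hdq : ∀ Y, deriv (q θ) Y = fderiv ℝ Q (Y, θ) (1, 0) := fun Y =>
      (hasDerivAt_slice_fst (hdiff hQ θ hθ Y)).deriv
    refine le_trans ?_ (add_le_add_left (le_self_add.trans le_self_add) _ :
      _ ≤ tangentNorm S t θ (q θ))
    simp only [hdx, hdx', hdξ, hdξ', hdq]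
    refine lintegral_enorm_le_add ?_ fun Y => ?_
    · have h1 := continuous_fderiv_slice hO hX hθ (0, 1)
      have h2 := continuous_fderiv_slice hO hX hθ (1, 0)
      have h3 : Continuous fun Y => q θ Y := continuous_slice hq.continuousOn hθ
      have h4 : Continuous fun Y => (S θ).ξ t Y := continuous_slice hξ.continuousOn hθ
      exact (h1.add (h2.mul h3)).mul h4
    · refine (abs_add_le _ _).trans (add_le_add ?_ ?_)
      · rw [abs_mul]
        exact mul_le_of_le_one_left (abs_nonneg _) (hf' _)
      · rw [abs_mul]
        exact mul_le_of_le_one_left (abs_nonneg _) (hf1 _)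

end Path

/-! ### The measure `ξ dY` at generic singularities -/

theorem countable_of_forall_eventually_notMem {Z : Set ℝ}
    (h : ∀ y ∈ Z, ∀ᶠ z in 𝓝[≠] y, z ∉ Z) : Z.Countable := by
  have : DiscreteTopology Z := by
    rw [discreteTopology_subtype_iff]
    intro y hy
    rw [inf_principal_eq_bot]
    exact h y hy
  exact countable_coe_iff.1 countable_of_Lindelof_of_discrete

namespace CharData

variable {T t : ℝ} {S : CharData}

/-- On `{α = π}`, the points with `α_Y ≠ 0` are isolated because `cos(α/2)` has a simple zero there,
and those with `α_Y = 0` because `α_YY ≠ 0`. -/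
theorem IsGeneric.countable_cos_eq_zero (h : S.IsGeneric T) (ht : t ∈ Icc 0 T) :
    {Y | Real.cos (S.α t Y / 2) = 0}.Countable := by
  have hα : ContDiff ℝ ∞ (S.α t) := by
    rw [← contDiffOn_univ]
    exact h.smooth_α.comp (f := fun Y : ℝ => (t, Y)) (by fun_prop) fun Y _ => ⟨ht, mem_univ _⟩
  have hd : ∀ Y, HasDerivAt (S.α t) (deriv (S.α t) Y) Y := fun Y =>
    (hα.differentiable (by simp) Y).hasDerivAt
  have hd' : Differentiable ℝ (deriv (S.α t)) :=
    (ContDiff.iterate_deriv' 1 1 (hα.of_le (by norm_cast))).differentiable one_ne_zero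
  set Z := {Y | Real.cos (S.α t Y / 2) = 0}
  have hZ : Z = (Z ∩ {Y | deriv (S.α t) Y ≠ 0}) ∪ (Z ∩ {Y | deriv (S.α t) Y = 0}) := by
    rw [← inter_union_distrib_left]
    ext Y
    simp only [mem_inter_iff, mem_union, mem_ofPred_eq]
    tauto
  rw [hZ]
  refine Countable.union (countable_of_forall_eventually_notMem ?_)
    (countable_of_forall_eventually_notMem ?_)
  · rintro Y ⟨hY, hY'⟩
    have hc : HasDerivAt (fun Z => Real.cos (S.α t Z / 2))
        (-Real.sin (S.α t Y / 2) * (deriv (S.α t) Y / 2)) Y := ((hd Y).div_const 2).cos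
    have hs : Real.sin (S.α t Y / 2) ≠ 0 := by
      intro h0
      have := Real.sin_sq_add_cos_sq (S.α t Y / 2)
      rw [h0, show Real.cos (S.α t Y / 2) = 0 from hY] at this
      norm_num at this
    have hne := hc.eventually_ne (c := 0)
      (mul_ne_zero (neg_ne_zero.2 hs) (div_ne_zero hY' two_ne_zero))
    filter_upwards [hne] with z hz hz'
    exact hz hz'.1
  · rintro Y ⟨hY, hY'⟩
    have h2 := (h.generic t ht Y hY hY').2
    rw [iteratedDeriv_succ, iteratedDeriv_one] at h2
    have hne := (hd' Y).hasDerivAt.eventually_ne (c := 0) h2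
    filter_upwards [hne] with z hz hz'
    exact hz hz'.2

/-- `U = u ∘ x⁻¹` near `x(Y)`, by the inverse function theorem. -/
theorem IsSolution.deriv_U (h : S.IsSolution T) (ht : t ∈ Icc 0 T) (hc : Continuous (S.xY t))
    {Y : ℝ} (hY : Real.cos (S.α t Y / 2) ≠ 0) :
    deriv (S.U t) (S.x t Y) = Real.tan (S.α t Y / 2) := by
  have hξ := h.ξ_pos t ht Y
  have hxY : S.xY t Y ≠ 0 := mul_ne_zero hξ.ne' (pow_ne_zero _ hY)
  have hstrict : HasStrictDerivAt (S.x t) (S.xY t Y) Y :=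
    hasStrictDerivAt_of_hasDerivAt_of_continuousAt (Eventually.of_forall (h.x_Y t ht))
      hc.continuousAt
  have hinv := hstrict.to_localInverse hxY
  have hright := hstrict.eventually_right_inverse hxY
  have hu := h.u_Y t ht Y
  set g := hstrict.localInverse _ _ _ hxY
  have hgY : g (S.x t Y) = Y :=
    (hstrict.hasStrictFDerivAt_equiv hxY).localInverse_apply_image
  have hcomp : HasDerivAt (fun z => S.u t (g z)) (S.uY t Y * (S.xY t Y)⁻¹) (S.x t Y) :=
    HasDerivAt.comp (S.x t Y) (h₂ := S.u t) (by rw [hgY]; exact hu) hinv.hasDerivAt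
  have hev : S.U t =ᶠ[𝓝 (S.x t Y)] fun z => S.u t (g z) := by
    filter_upwards [hright] with z hz
    rw [← h.graph t ht, show S.x t (g z) = z from hz]
  rw [(hcomp.congr_of_eventuallyEq hev).deriv, Real.tan_eq_sin_div_cos, uY, xY]
  have hsin : Real.sin (S.α t Y) = 2 * Real.sin (S.α t Y / 2) * Real.cos (S.α t Y / 2) := by
    rw [← Real.sin_two_mul]; congr 1; ring
  rw [hsin]
  field_simp

theorem IsSolution.xY_mul_density (h : S.IsSolution T) (ht : t ∈ Icc 0 T)
    (hc : Continuous (S.xY t)) {Y : ℝ} (hY : Real.cos (S.α t Y / 2) ≠ 0) :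
    S.xY t Y * density (S.U t) (S.x t Y) = S.ξ t Y := by
  rw [density, h.deriv_U ht hc hY, xY, Real.tan_eq_sin_div_cos]
  have h1 : 1 + (Real.sin (S.α t Y / 2) / Real.cos (S.α t Y / 2)) ^ 2
      = (Real.cos (S.α t Y / 2) ^ 2)⁻¹ := by
    field_simp
    linarith [Real.sin_sq_add_cos_sq (S.α t Y / 2)]
  rw [h1]
  field_simp

theorem IsSolution.injOn_x (h : S.IsSolution T) (ht : t ∈ Icc 0 T) :
    InjOn (S.x t) {Y | Real.cos (S.α t Y / 2) ≠ 0} := by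
  have key : ∀ Y Z, Real.cos (S.α t Y / 2) ≠ 0 → S.x t Y = S.x t Z → ¬ Y < Z := by
    intro Y Z hY hYZ hlt
    have hconst : ∀ W ∈ Icc Y Z, S.x t W = S.x t Y := fun W hW =>
      le_antisymm ((h.monotone_x ht hW.2).trans hYZ.ge) (h.monotone_x ht hW.1)
    have h1 : HasDerivWithinAt (S.x t) (S.xY t Y) (Icc Y Z) Y :=
      (h.x_Y t ht Y).hasDerivWithinAt
    have h2 : HasDerivWithinAt (S.x t) 0 (Icc Y Z) Y :=
      (hasDerivWithinAt_const Y (Icc Y Z) (S.x t Y)).congr hconst rfl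
    have h3 := (uniqueDiffOn_Icc hlt Y (left_mem_Icc.2 hlt.le)).eq_deriv _ h1 h2
    exact mul_ne_zero (h.ξ_pos t ht Y).ne' (pow_ne_zero _ hY) h3
  intro Y hY Z hZ hYZ
  exact le_antisymm (not_lt.1 (key Z Y hZ hYZ.symm)) (not_lt.1 (key Y Z hY hYZ))

/-- For a generic solution the image of `ξ dY` under `x(·)` is the absolutely continuous measure
`(1 + u_x²)² dx`, tested against `f` with support in `x([a, b])`. -/
theorem IsSolution.integral_comp_x_mul_ξ (h : S.IsSolution T) (hgen : S.IsGeneric T)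
    (ht : t ∈ Icc 0 T) (hc : Continuous (S.xY t)) {f : ℝ → ℝ} {a b : ℝ}
    (hfa : ∀ Y ≤ a, f (S.x t Y) = 0) (hfb : ∀ Y, b ≤ Y → f (S.x t Y) = 0) :
    ∫ Y in a..b, f (S.x t Y) * S.ξ t Y = ∫ x, f x * density (S.U t) x := by
  set s := {Y | Real.cos (S.α t Y / 2) ≠ 0}
  have hsc : sᶜ.Countable := by
    have := hgen.countable_cos_eq_zero ht
    convert this using 1
    ext Y; simp [s]
  have hs : MeasurableSet s := hsc.measurableSet.of_compl
  have h1 : ∫ Y in a..b, f (S.x t Y) * S.ξ t Y = ∫ Y, f (S.x t Y) * S.ξ t Y := by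
    refine intervalIntegral.integral_eq_integral_of_support_subset fun Y hY => ?_
    constructor
    · by_contra! hle
      exact hY (by simp [hfa Y hle])
    · by_contra! hle
      exact hY (by simp [hfb Y hle.le])
  have h2 : ∫ Y, f (S.x t Y) * S.ξ t Y = ∫ Y in s, f (S.x t Y) * S.ξ t Y := by
    rw [← setIntegral_univ (μ := volume)]
    exact setIntegral_congr_set (eventuallyEq_univ.2 (hsc.measure_zero volume)).symm
  have h3 : ∫ Y in s, f (S.x t Y) * S.ξ t Y
      = ∫ Y in s, |S.xY t Y| • (f (S.x t Y) * density (S.U t) (S.x t Y)) := by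
    refine setIntegral_congr_fun hs fun Y hY => ?_
    have hnn : 0 ≤ S.xY t Y := mul_nonneg (h.ξ_pos t ht Y).le (by positivity)
    simp only [smul_eq_mul]
    rw [abs_of_nonneg hnn, ← h.xY_mul_density ht hc hY]
    ring
  rw [h1, h2, h3, ← integral_image_eq_integral_abs_deriv_smul hs
    (f' := S.xY t) (fun Y _ => (h.x_Y t ht Y).hasDerivWithinAt) (h.injOn_x ht)
    (fun x => f x * density (S.U t) x)]
  have hic : (S.x t '' s)ᶜ.Countable := by
    refine (hsc.image (S.x t)).mono fun x hx => ?_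
    obtain ⟨Y, rfl⟩ := h.x_surj t ht x
    exact ⟨Y, fun hY => hx ⟨Y, hY, rfl⟩, rfl⟩
  rw [← setIntegral_univ (μ := volume)]
  refine setIntegral_congr_set ?_
  exact eventuallyEq_univ.2 (hic.measure_zero volume)

end CharData

/-! ### Functionals bounded by the length of paths -/

variable {T t E₁ E₂ : ℝ}

theorem edist_integral_mul_le_pathDist (ht : t ∈ Icc 0 T) {φ : ℝ → ℝ} (hφ : ContDiff ℝ 1 φ)
    (hφc : HasCompactSupport φ) (hφ1 : ∀ x, |φ x| ≤ 1) (a b : ℝ → ℝ) :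
    edist (∫ x, φ x * a x) (∫ x, φ x * b x) ≤ pathDist T t E₁ E₂ a b := by
  simp only [pathDist, le_iInf_iff]
  rintro S B q hp ⟨-, rfl⟩ ⟨-, rfl⟩ - hq
  rw [edist_comm, edist_eq_enorm_sub]
  exact hp.enorm_integral_mul_sub_le ht hq hφ hφc hφ1

theorem edist_integral_density_le_pathDist (ht : t ∈ Icc 0 T) {f : ℝ → ℝ}
    (hf : ContDiff ℝ 1 f) (hfc : HasCompactSupport f) (hf1 : ∀ x, |f x| ≤ 1)
    (hf' : ∀ x, |deriv f x| ≤ 1) (a b : ℝ → ℝ) :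
    edist (∫ x, f x * density a x) (∫ x, f x * density b x) ≤ pathDist T t E₁ E₂ a b := by
  simp only [pathDist, le_iInf_iff]
  rintro S B q hp ⟨h0, rfl⟩ ⟨h1, rfl⟩ - hq
  obtain ⟨R, -, hR⟩ := hfc.exists_pos_le_norm
  obtain ⟨A', B', hAB⟩ := hp.exists_bounds ht R
  have hA : ∀ θ ∈ Icc (0 : ℝ) 1, ∀ Y ≤ A', f ((S θ).x t Y) = 0 := fun θ hθ Y hY =>
    hR _ (by
      have := (hAB θ hθ).1 Y hY
      rw [Real.norm_eq_abs]; exact (by linarith : R ≤ -(S θ).x t Y).trans (neg_le_abs _))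
  have hB : ∀ θ ∈ Icc (0 : ℝ) 1, ∀ Y, B' ≤ Y → f ((S θ).x t Y) = 0 := fun θ hθ Y hY =>
    hR _ (((hAB θ hθ).2 Y hY).trans (le_abs_self _))
  have hmc := hp.continuousOn_xY ht
  have hm0 : (0 : ℝ) ∈ Icc (0 : ℝ) 1 := by simp
  have hm1 : (1 : ℝ) ∈ Icc (0 : ℝ) 1 := by simp
  rw [edist_comm, edist_eq_enorm_sub,
    ← h0.solution.integral_comp_x_mul_ξ h0.generic ht (continuous_slice hmc hm0) (hA 0 hm0)
      (hB 0 hm0),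
    ← h1.solution.integral_comp_x_mul_ξ h1.generic ht (continuous_slice hmc hm1) (hA 1 hm1)
      (hB 1 hm1)]
  exact hp.enorm_integral_measure_sub_le ht hq hf (fun θ hθ => hA θ hθ _ le_rfl)
    (fun θ hθ => hB θ hθ _ le_rfl) hf1 hf'

/-- Approximation by profiles at infinite path distance plays no role in `limitDist`, and the others
are Sobolev functions, for which `sobolevDist` has no junk values. -/
theorem memH1W14_of_pathDist_ne_top {a b : ℝ → ℝ} (h : pathDist T t E₁ E₂ a b ≠ ⊤) :
    MemH1W14 a ∧ MemH1W14 b := by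
  simp only [pathDist, ne_eq, iInf_eq_top, not_forall] at h
  obtain ⟨S, B, q, -, ⟨-, rfl⟩, ⟨-, rfl⟩, hmem, -⟩ := h
  exact ⟨(hmem 0 (by simp)).1, (hmem 1 (by simp)).1⟩

/-! ### From path lengths to `distStar` -/

/-- Continuity of a functional on `H¹ ∩ W^{1,4}` at each `u`, with a linear modulus `K` (depending on
`u`) on the unit ball about `u`. -/
def IsLocallyLipschitzFunctional (I : (ℝ → ℝ) → ℝ) : Prop :=
  ∀ u, MemH1W14 u → ∃ K : ℝ≥0∞, K ≠ ⊤ ∧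
    ∀ a, MemH1W14 a → sobolevDist a u ≤ 1 → edist (I a) (I u) ≤ K * sobolevDist a u

namespace IsLocallyLipschitzFunctional

variable {I : (ℝ → ℝ) → ℝ}

theorem exists_edist_le (hI : IsLocallyLipschitzFunctional I) {u : ℝ → ℝ} (hu : MemH1W14 u)
    {η : ℝ≥0∞} (hη : η ≠ 0) :
    ∃ δ : ℝ≥0∞, 0 < δ ∧ ∀ a, MemH1W14 a → sobolevDist a u < δ → edist (I a) (I u) ≤ η := by
  obtain ⟨K, hK, h⟩ := hI u hu
  obtain ⟨n, hn, hnK⟩ := ENNReal.exists_nnreal_pos_mul_lt hK hη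
  refine ⟨min n 1, by simpa using hn, fun a ha had => ?_⟩
  refine (h a ha (had.le.trans (min_le_right _ _))).trans ?_
  rw [mul_comm]
  exact (mul_le_mul_left (had.le.trans (min_le_left _ _)) K).trans hnK.le

theorem edist_le_limitDist (hI : IsLocallyLipschitzFunctional I)
    (hpath : ∀ a b, edist (I a) (I b) ≤ pathDist T t E₁ E₂ a b) {u u' : ℝ → ℝ}
    (hu : MemH1W14 u) (hu' : MemH1W14 u') :
    edist (I u) (I u') ≤ limitDist T t E₁ E₂ u u' := by
  refine ENNReal.le_of_forall_pos_le_add fun η hη _ => ?_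
  have hη2 : (η : ℝ≥0∞) / 2 ≠ 0 := by simpa using hη.ne'
  obtain ⟨δ, hδ, h⟩ := hI.exists_edist_le hu hη2
  obtain ⟨δ', hδ', h'⟩ := hI.exists_edist_le hu' hη2
  rw [← tsub_le_iff_right]
  refine le_iSup₂_of_le (min δ δ') (lt_min hδ hδ') ?_
  refine le_iInf fun a => le_iInf fun b => le_iInf fun ha => le_iInf fun hb => ?_
  rcases eq_or_ne (pathDist T t E₁ E₂ a b) ⊤ with htop | htop
  · simp [htop]
  obtain ⟨hma, hmb⟩ := memH1W14_of_pathDist_ne_top htop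
  rw [tsub_le_iff_right]
  calc edist (I u) (I u') ≤ edist (I u) (I a) + edist (I a) (I b) + edist (I b) (I u') :=
        edist_triangle4 _ _ _ _
    _ ≤ η / 2 + pathDist T t E₁ E₂ a b + η / 2 := by
        gcongr
        · rw [edist_comm]; exact h a hma (ha.trans_le (min_le_left _ _))
        · exact hpath a b
        · exact h' b hmb (hb.trans_le (min_le_right _ _))
    _ = pathDist T t E₁ E₂ a b + η := by
        rw [add_comm (_ / 2 : ℝ≥0∞), add_assoc, ENNReal.add_halves]

theorem edist_le_distStar (hI : IsLocallyLipschitzFunctional I)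
    (hpath : ∀ a b, edist (I a) (I b) ≤ pathDist T t E₁ E₂ a b) (u u' : ℝ → ℝ) :
    edist (I u) (I u') ≤ distStar T t E₁ E₂ u u' := by
  simp only [distStar, le_iInf_iff]
  rintro n w hw rfl rfl
  refine (edist_le_range_sum_edist (fun i => I (w i)) n).trans
    (Finset.sum_le_sum fun i hi => ?_)
  rw [Finset.mem_range] at hi
  exact hI.edist_le_limitDist hpath (hw i hi.le).1 (hw (i + 1) hi).1

end IsLocallyLipschitzFunctional

/-! ### Continuity of the two functionals -/

theorem isLocallyLipschitzFunctional_integral_mul {φ : ℝ → ℝ} (hφ : Continuous φ)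
    (hφc : HasCompactSupport φ) : IsLocallyLipschitzFunctional fun u => ∫ x, φ x * u x := by
  have hφ2 : MemLp φ 2 volume := hφ.memLp_of_hasCompactSupport hφc
  have hint : ∀ a, MemH1W14 a → Integrable fun x => φ x * a x := fun a ha =>
    (hφ.mul ha.continuous).integrable_of_hasCompactSupport hφc.mul_right
  refine fun u hu => ⟨eLpNorm φ 2 volume, hφ2.eLpNorm_ne_top, fun a ha _ => ?_⟩
  rw [edist_eq_enorm_sub, ← integral_sub (hint a ha) (hint u hu)]
  refine (enorm_integral_le_lintegral_enorm _).trans ?_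
  rw [← eLpNorm_one_eq_lintegral_enorm]
  have h1 : (fun x => φ x * a x - φ x * u x) = φ • fun x => a x - u x := by
    ext x; simp [mul_sub]
  rw [h1]
  refine (eLpNorm_smul_le_mul_eLpNorm (p := 2) (q := 2)
    (ha.continuous.sub hu.continuous).aestronglyMeasurable hφ.aestronglyMeasurable).trans ?_
  gcongr
  exact le_self_add.trans (le_self_add.trans le_self_add)

theorem MemH1W14.integrable_density_sub_one {u : ℝ → ℝ} (hu : MemH1W14 u) :
    Integrable fun x => density u x - 1 := by
  have h4 : Integrable fun x => deriv u x ^ 4 := by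
    have := hu.deriv_memLp_four.integrable_norm_pow (p := 4) (by norm_num)
    simpa [Even.pow_abs (by decide : Even 4)] using this
  refine ((hu.deriv_memLp_two.integrable_sq.const_mul 2).add h4).congr (ae_of_all _ fun x => ?_)
  simp only [density, Pi.add_apply]
  ring

theorem MemH1W14.integrable_density_sub {u u' : ℝ → ℝ} (hu : MemH1W14 u) (hu' : MemH1W14 u') :
    Integrable fun x => density u x - density u' x :=
  (hu.integrable_density_sub_one.sub hu'.integrable_density_sub_one).congr
    (ae_of_all _ fun x => by simp)

theorem MemH1W14.integrable_mul_density {u f : ℝ → ℝ} (hu : MemH1W14 u) (hf : Continuous f)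
    (hfc : HasCompactSupport f) : Integrable fun x => f x * density u x := by
  obtain ⟨C, hC⟩ := hfc.exists_bound_of_continuous hf
  have h := (hu.integrable_density_sub_one.bdd_mul hf.aestronglyMeasurable
    (ae_of_all _ hC)).add (hf.integrable_of_hasCompactSupport hfc)
  refine h.congr (ae_of_all _ fun x => ?_)
  simp only [Pi.add_apply]
  ring

/-- `1/4 + 1/4 = 1/2`, for the product of two functions in `L⁴`. -/
instance holderTriple_four_four_two : ENNReal.HolderTriple 4 4 2 where
  inv_add_inv_eq_inv := by
    rw [← two_mul, show (4 : ℝ≥0∞) = 2 * 2 by norm_num,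
      ENNReal.mul_inv (by simp) (by simp), ← mul_assoc, ENNReal.mul_inv_cancel (by simp) (by simp),
      one_mul]

theorem exists_eLpNorm_density_sub_le {u : ℝ → ℝ} (hu : MemH1W14 u) :
    ∃ K : ℝ≥0∞, K ≠ ⊤ ∧ ∀ a, MemH1W14 a → sobolevDist a u ≤ 1 →
      eLpNorm (fun x => density a x - density u x) 1 volume ≤ K * sobolevDist a u := by
  set n₂ := eLpNorm (deriv u) 2 volume with hn₂
  set n₄ := eLpNorm (deriv u) 4 volume with hn₄
  have hn₂' : n₂ ≠ ⊤ := hu.deriv_memLp_two.eLpNorm_ne_top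
  have hn₄' : n₄ ≠ ⊤ := hu.deriv_memLp_four.eLpNorm_ne_top
  refine ⟨2 * (1 + 2 * n₂) + (1 + 2 * n₄) * ((1 + n₄) * (1 + n₄) + n₄ * n₄), by finiteness,
    fun a ha had => ?_⟩
  set δ := sobolevDist a u with hδ
  set v := deriv u with hv
  set d : ℝ → ℝ := fun x => deriv a x - v x with hd
  have hd₂ : MemLp d 2 volume := ha.deriv_memLp_two.sub hu.deriv_memLp_two
  have hδ₂ : eLpNorm d 2 volume ≤ δ :=
    le_add_self.trans (le_self_add.trans le_self_add)
  have hδ₄ : eLpNorm d 4 volume ≤ δ := le_add_self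
  have hdm := hd₂.1
  have hvm : AEStronglyMeasurable v volume := hu.deriv_memLp_two.1
  have hs : ∀ p : ℝ≥0∞, 1 ≤ p → eLpNorm d p volume ≤ δ →
      eLpNorm (d + (2 : ℝ) • v) p volume ≤ 1 + 2 * eLpNorm v p volume := by
    intro p hp hdp
    refine (eLpNorm_add_le hdm (hvm.const_smul 2) hp).trans (add_le_add (hdp.trans had) ?_)
    rw [eLpNorm_const_smul]
    simp [Real.enorm_eq_ofReal_abs]
  have hav : eLpNorm (d + v) 4 volume ≤ 1 + n₄ :=
    (eLpNorm_add_le hdm hvm (by norm_num)).trans (by gcongr; exact hδ₄.trans had)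
  have hsm : AEStronglyMeasurable (d + (2 : ℝ) • v) volume := hdm.add (hvm.const_smul 2)
  have hsq : eLpNorm ((d + v) • (d + v) + v • v) 2 volume ≤ (1 + n₄) * (1 + n₄) + n₄ * n₄ := by
    refine (eLpNorm_add_le ((hdm.add hvm).smul (hdm.add hvm)) (hvm.smul hvm) (by norm_num)).trans ?_
    refine add_le_add ?_ (eLpNorm_smul_le_mul_eLpNorm hvm hvm)
    exact (eLpNorm_smul_le_mul_eLpNorm (hdm.add hvm) (hdm.add hvm)).trans (by gcongr)
  -- With `d = a_x - u_x`, `(1 + a_x²)² - (1 + u_x²)² = (a_x² - u_x²)(2 + a_x² + u_x²)`.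
  have hid : (fun x => density a x - density u x) = (2 : ℝ) • (d • (d + (2 : ℝ) • v))
      + (d • (d + (2 : ℝ) • v)) • ((d + v) • (d + v) + v • v) := by
    ext x
    simp only [density, Pi.add_apply, Pi.smul_apply, smul_eq_mul, Pi.mul_apply, hd, hv]
    ring
  rw [hid]
  have hprod : AEStronglyMeasurable (d • (d + (2 : ℝ) • v)) volume := hdm.smul hsm
  refine (eLpNorm_add_le (hprod.const_smul 2)
    (hprod.smul (((hdm.add hvm).smul (hdm.add hvm)).add (hvm.smul hvm))) le_rfl).trans ?_
  rw [add_mul, eLpNorm_const_smul]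
  refine add_le_add ?_ ?_
  · have h2 : ‖(2 : ℝ)‖ₑ = 2 := by simp [Real.enorm_eq_ofReal_abs]
    rw [h2, mul_assoc]
    gcongr
    rw [mul_comm]
    refine (eLpNorm_smul_le_mul_eLpNorm (p := 2) (q := 2) hsm hdm).trans ?_
    exact mul_le_mul' hδ₂ (hs 2 (by norm_num) hδ₂)
  · refine (eLpNorm_smul_le_mul_eLpNorm (p := 2) (q := 2)
      (((hdm.add hvm).smul (hdm.add hvm)).add (hvm.smul hvm)) hprod).trans ?_
    rw [mul_comm _ δ, ← mul_assoc]
    refine mul_le_mul' ?_ hsq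
    refine (eLpNorm_smul_le_mul_eLpNorm (p := 4) (q := 4) hsm hdm).trans ?_
    exact mul_le_mul' hδ₄ (hs 4 (by norm_num) hδ₄)

theorem isLocallyLipschitzFunctional_integral_density {f : ℝ → ℝ} (hf : Continuous f)
    (hfc : HasCompactSupport f) (hf1 : ∀ x, |f x| ≤ 1) :
    IsLocallyLipschitzFunctional fun u => ∫ x, f x * density u x := by
  intro u hu
  obtain ⟨K, hK, h⟩ := exists_eLpNorm_density_sub_le hu
  refine ⟨K, hK, fun a ha had => ?_⟩
  rw [edist_eq_enorm_sub, ← integral_sub (ha.integrable_mul_density hf hfc)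
    (hu.integrable_mul_density hf hfc)]
  refine (enorm_integral_le_lintegral_enorm _).trans (le_trans ?_ (h a ha had))
  rw [eLpNorm_one_eq_lintegral_enorm]
  refine lintegral_mono fun x => ?_
  rw [← mul_sub, enorm_mul]
  exact mul_le_of_le_one_left' (by
    rw [Real.enorm_eq_ofReal_abs]; exact ENNReal.ofReal_le_one.2 (hf1 x))

/-! ### Test functions -/

/-- Cutoffs that exhaust the line and whose derivatives tend to `0` uniformly. -/
theorem exists_contDiff_cutoff : ∃ (χ : ℕ → ℝ → ℝ) (ε : ℕ → ℝ), Tendsto ε atTop (𝓝 0) ∧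
    (∀ n, 0 ≤ ε n) ∧ ∀ n, ContDiff ℝ 1 (χ n) ∧ HasCompactSupport (χ n) ∧ (∀ x, |χ n x| ≤ 1) ∧
      (∀ x, |deriv (χ n) x| ≤ ε n) ∧ ∀ x, |x| ≤ (n : ℝ) → χ n x = 1 := by
  let b : ContDiffBump (0 : ℝ) := ⟨1, 2, zero_lt_one, one_lt_two⟩
  have hb : ContDiff ℝ 1 b := b.contDiff
  obtain ⟨M, hM⟩ := (b.hasCompactSupport.deriv).exists_bound_of_continuous
    (hb.continuous_deriv le_rfl)
  have hM0 : 0 ≤ M := (norm_nonneg _).trans (hM 0)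
  refine ⟨fun n x => b ((n + 1 : ℝ)⁻¹ * x), fun n => (n + 1 : ℝ)⁻¹ * M, ?_, fun n => by positivity,
    fun n => ⟨by fun_prop, ?_, fun x => ?_, fun x => ?_, fun x hx => ?_⟩⟩
  · have := (tendsto_one_div_add_atTop_nhds_zero_nat (𝕜 := ℝ)).mul_const M
    simpa using this
  · exact b.hasCompactSupport.comp_homeomorph
      (Homeomorph.mulLeft₀ ((n + 1 : ℝ)⁻¹) (by positivity))
  · rw [abs_of_nonneg b.nonneg]
    exact b.le_one
  · have h : HasDerivAt (fun x => b ((n + 1 : ℝ)⁻¹ * x))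
        (deriv b ((n + 1 : ℝ)⁻¹ * x) * ((n + 1 : ℝ)⁻¹ * 1)) x :=
      HasDerivAt.comp (h₂ := b) x (hb.differentiable one_ne_zero _).hasDerivAt
        ((hasDerivAt_id x).const_mul _)
    rw [h.deriv, abs_mul, mul_one, abs_of_pos (a := (n + 1 : ℝ)⁻¹) (by positivity)]
    exact (mul_le_mul_of_nonneg_right (hM _) (by positivity)).trans_eq (mul_comm _ _)
  · apply b.one_of_mem_closedBall
    rw [mem_closedBall_zero_iff, norm_mul, Real.norm_eq_abs, Real.norm_eq_abs,
      abs_of_pos (a := (n + 1 : ℝ)⁻¹) (by positivity)]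
    rw [inv_mul_le_iff₀ (by positivity)]
    show |x| ≤ (n + 1) * 1
    linarith

theorem enorm_integral_mul_le_of_tendsto {w : ℝ → ℝ} (hw : Integrable w) {D : ℝ≥0∞}
    {ψ : ℕ → ℝ → ℝ} {ψ' : ℝ → ℝ} (hc : ∀ n, Continuous (ψ n)) (hψ : ∀ n x, |ψ n x| ≤ 1)
    (hlim : ∀ x, Tendsto (fun n => ψ n x * w x) atTop (𝓝 (ψ' x)))
    (h : ∀ n, ‖∫ x, ψ n x * w x‖ₑ ≤ D) : ‖∫ x, ψ' x‖ₑ ≤ D := by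
  have ht : Tendsto (fun n => ∫ x, ψ n x * w x) atTop (𝓝 (∫ x, ψ' x)) := by
    refine tendsto_integral_of_dominated_convergence (fun x => |w x|)
      (fun n => (hc n).aestronglyMeasurable.mul hw.1) hw.abs (fun n => ae_of_all _ fun x => ?_)
      (ae_of_all _ hlim)
    rw [Real.norm_eq_abs, abs_mul]
    exact mul_le_of_le_one_left (abs_nonneg _) (hψ n x)
  exact le_of_tendsto ht.enorm (Eventually.of_forall h)

/-- A continuous `ψ` is the limit of its averages over `[x, x + ε]`, which are of class `C¹`. -/
theorem enorm_integral_mul_le_of_continuous {w : ℝ → ℝ} (hw : Integrable w) {D : ℝ≥0∞}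
    (h : ∀ φ : ℝ → ℝ, ContDiff ℝ 1 φ → HasCompactSupport φ → (∀ x, |φ x| ≤ 1) →
      ‖∫ x, φ x * w x‖ₑ ≤ D) {ψ : ℝ → ℝ} (hψ : Continuous ψ) (hψc : HasCompactSupport ψ)
    (hψ1 : ∀ x, |ψ x| ≤ 1) : ‖∫ x, ψ x * w x‖ₑ ≤ D := by
  obtain ⟨R, -, hR⟩ := hψc.exists_pos_le_norm
  set Ψ : ℝ → ℝ := fun x => ∫ y in (0 : ℝ)..x, ψ y with hΨ
  have hΨd : ∀ x, HasDerivAt Ψ (ψ x) x := fun x => hψ.integral_hasStrictDerivAt 0 x |>.hasDerivAt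
  have hΨ1 : ContDiff ℝ 1 Ψ := by
    rw [contDiff_one_iff_deriv]
    exact ⟨fun x => (hΨd x).differentiableAt, by
      rwa [show deriv Ψ = ψ from funext fun x => (hΨd x).deriv]⟩
  have hsub : ∀ x y, Ψ y - Ψ x = ∫ s in x..y, ψ s := fun x y =>
    intervalIntegral.integral_interval_sub_left (hψ.intervalIntegrable _ _)
      (hψ.intervalIntegrable _ _)
  let ε : ℕ → ℝ := fun n => 1 / ((n : ℝ) + 1)
  have hε : ∀ n, 0 < ε n := fun n => Nat.one_div_pos_of_nat
  have hε1 : ∀ n, ε n ≤ 1 := fun n => by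
    simp only [ε]; rw [div_le_one (by positivity)]; linarith [n.cast_nonneg (α := ℝ)]
  have hCD : ∀ n, ContDiff ℝ 1 fun x => (ε n)⁻¹ * (Ψ (x + ε n) - Ψ x) := fun n => by fun_prop
  have hb : ∀ n x, |(ε n)⁻¹ * (Ψ (x + ε n) - Ψ x)| ≤ 1 := fun n x => by
    have h1 := intervalIntegral.norm_integral_le_of_norm_le_const (f := ψ) (C := 1)
      (a := x) (b := x + ε n) fun y _ => hψ1 y
    rw [← hsub, add_sub_cancel_left, one_mul, Real.norm_eq_abs, abs_of_pos (hε n)] at h1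
    rw [abs_mul, abs_of_pos (inv_pos.2 (hε n)), inv_mul_le_iff₀ (hε n), mul_one]
    exact h1
  refine enorm_integral_mul_le_of_tendsto hw
    (ψ := fun n x => (ε n)⁻¹ * (Ψ (x + ε n) - Ψ x)) (fun n => (hCD n).continuous) hb
    (fun x => Tendsto.mul_const _ ?_) fun n => h _ (hCD n) ?_ (hb n)
  · have h0 : Tendsto ε atTop (𝓝[≠] 0) := tendsto_nhdsWithin_iff.2
      ⟨tendsto_one_div_add_atTop_nhds_zero_nat, Eventually.of_forall fun n => (hε n).ne'⟩
    exact (hasDerivAt_iff_tendsto_slope_zero.1 (hΨd x)).comp h0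
  · refine HasCompactSupport.intro (isCompact_Icc (a := -(R + 1)) (b := R + 1)) fun x hx => ?_
    rw [hsub, intervalIntegral.integral_zero_ae, mul_zero]
    refine ae_of_all _ fun y hy => hR y ?_
    rw [uIoc_of_le (by linarith [hε n])] at hy
    rw [mem_Icc, not_and_or, not_le, not_le] at hx
    rw [Real.norm_eq_abs, le_abs]
    have := hε1 n
    rcases hx with hx | hx
    · right; linarith [hy.2]
    · left; linarith [hy.1]

/-- Duality for the `L¹` norm. The test functions `χₙ w / (|w| + εₙ)` approximate the sign of `w`. -/
theorem eLpNorm_one_le_of_forall_contDiff {w : ℝ → ℝ} (hw : Integrable w) (hwc : Continuous w)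
    {D : ℝ≥0∞} (h : ∀ φ : ℝ → ℝ, ContDiff ℝ 1 φ → HasCompactSupport φ → (∀ x, |φ x| ≤ 1) →
      ‖∫ x, φ x * w x‖ₑ ≤ D) : eLpNorm w 1 volume ≤ D := by
  obtain ⟨χ, _, _, _, hχ⟩ := exists_contDiff_cutoff
  let ε : ℕ → ℝ := fun n => 1 / ((n : ℝ) + 1)
  have hε : ∀ n, 0 < ε n := fun n => Nat.one_div_pos_of_nat
  have hpos : ∀ n x, 0 < |w x| + ε n := fun n x => add_pos_of_nonneg_of_pos (abs_nonneg _) (hε n)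
  have hs : ∀ n, Continuous fun x => w x / (|w x| + ε n) := fun n =>
    hwc.div (hwc.abs.add continuous_const) fun x => (hpos n x).ne'
  have hb : ∀ n x, |χ n x * (w x / (|w x| + ε n))| ≤ 1 := fun n x => by
    rw [abs_mul, abs_div, abs_of_pos (hpos n x)]
    exact mul_le_one₀ ((hχ n).2.2.1 x) (by have := hpos n x; positivity)
      ((div_le_one (hpos n x)).2 (by linarith [hε n]))
  have key : ‖∫ x, |w x|‖ₑ ≤ D := by
    refine enorm_integral_mul_le_of_tendsto hw (ψ := fun n x => χ n x * (w x / (|w x| + ε n)))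
      (fun n => (hχ n).1.continuous.mul (hs n)) hb (fun x => ?_) fun n =>
      enorm_integral_mul_le_of_continuous hw h ((hχ n).1.continuous.mul (hs n))
        (hχ n).2.1.mul_right (hb n)
    have hχ1 : Tendsto (fun n => χ n x) atTop (𝓝 1) := by
      refine tendsto_const_nhds.congr' ?_
      filter_upwards [eventually_ge_atTop ⌈|x|⌉₊] with n hn
      exact ((hχ n).2.2.2.2 x (Nat.ceil_le.1 hn)).symm
    rcases eq_or_ne (w x) 0 with h0 | h0
    · simp [h0]
    have h1 : Tendsto (fun n => |w x| + ε n) atTop (𝓝 (|w x| + 0)) :=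
      tendsto_const_nhds.add tendsto_one_div_add_atTop_nhds_zero_nat
    have h2 := (hχ1.mul ((tendsto_const_nhds (x := w x)).div h1 (by simpa using h0))).mul_const (w x)
    rw [one_mul, add_zero, div_mul_eq_mul_div, ← abs_mul_abs_self, mul_self_div_self] at h2
    exact h2
  rw [eLpNorm_one_eq_lintegral_enorm, ← ofReal_integral_norm_eq_lintegral_enorm hw]
  rwa [Real.enorm_eq_ofReal (integral_nonneg fun x => abs_nonneg _)] at key

/-- Multiplication by a cutoff `χₙ` with `|χₙ'| ≤ εₙ` keeps `|f'| ≤ 1 + εₙ`, hence the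
normalization by `1 + εₙ`. -/
theorem enorm_integral_mul_le_of_hasCompactSupport {w : ℝ → ℝ} (hw : Integrable w) {D : ℝ≥0∞}
    (h : ∀ f : ℝ → ℝ, ContDiff ℝ 1 f → HasCompactSupport f → (∀ x, |f x| ≤ 1) →
      (∀ x, |deriv f x| ≤ 1) → ‖∫ x, f x * w x‖ₑ ≤ D)
    {f : ℝ → ℝ} (hf : ContDiff ℝ 1 f) (hf1 : ∀ x, |f x| ≤ 1) (hf' : ∀ x, |deriv f x| ≤ 1) :
    ‖∫ x, f x * w x‖ₑ ≤ D := by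
  obtain ⟨χ, ε, hε, hε0, hχ⟩ := exists_contDiff_cutoff
  have hpos : ∀ n, 0 < 1 + ε n := fun n => by linarith [hε0 n]
  have hCD : ∀ n, ContDiff ℝ 1 fun x => (1 + ε n)⁻¹ * (f x * χ n x) := fun n =>
    contDiff_const.mul (hf.mul (hχ n).1)
  have hb : ∀ n x, |(1 + ε n)⁻¹ * (f x * χ n x)| ≤ 1 := fun n x => by
    rw [abs_mul, abs_mul, abs_of_pos (inv_pos.2 (hpos n))]
    exact mul_le_one₀ (inv_le_one_of_one_le₀ (by linarith [hε0 n])) (by positivity)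
      (mul_le_one₀ (hf1 x) (abs_nonneg _) ((hχ n).2.2.1 x))
  refine enorm_integral_mul_le_of_tendsto hw (ψ := fun n x => (1 + ε n)⁻¹ * (f x * χ n x))
    (fun n => (hCD n).continuous) hb (fun x => Tendsto.mul_const _ ?_) fun n =>
    h _ (hCD n) (hχ n).2.1.mul_left.mul_left (hb n) fun x => ?_
  · have h1 : Tendsto (fun n => (1 + ε n)⁻¹) atTop (𝓝 (1 + 0)⁻¹) :=
      (hε.const_add 1).inv₀ (by norm_num)
    have hχ1 : Tendsto (fun n => χ n x) atTop (𝓝 1) := by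
      refine tendsto_const_nhds.congr' ?_
      filter_upwards [eventually_ge_atTop ⌈|x|⌉₊] with n hn
      exact ((hχ n).2.2.2.2 x (Nat.ceil_le.1 hn)).symm
    simpa using h1.mul (hχ1.const_mul (f x))
  · have hd := (((hf.differentiable one_ne_zero x).hasDerivAt.mul
      ((hχ n).1.differentiable one_ne_zero x).hasDerivAt).const_mul (1 + ε n)⁻¹)
    rw [show deriv (fun x => (1 + ε n)⁻¹ * (f x * χ n x)) x = _ from hd.deriv, abs_mul,
      abs_of_pos (inv_pos.2 (hpos n)), inv_mul_le_iff₀ (hpos n), mul_one]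
    refine (abs_add_le _ _).trans (add_le_add ?_ ?_)
    · rw [abs_mul]
      exact mul_le_one₀ (hf' x) (abs_nonneg _) ((hχ n).2.2.1 x)
    · rw [abs_mul]
      exact (mul_le_of_le_one_left (abs_nonneg _) (hf1 x)).trans ((hχ n).2.2.2.1 x)

/-! ### The two comparisons -/

theorem eLpNorm_one_sub_le_distStar (ht : t ∈ Icc 0 T) {u u' : ℝ → ℝ} (hu : MemSpace u)
    (hu' : MemSpace u') :
    eLpNorm (fun x => u x - u' x) 1 volume ≤ distStar T t E₁ E₂ u u' := by
  refine eLpNorm_one_le_of_forall_contDiff (hu.2.sub hu'.2)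
    (hu.1.continuous.sub hu'.1.continuous) fun φ hφ hφc hφ1 => ?_
  have hint : ∀ a, MemSpace a → Integrable fun x => φ x * a x := fun a ha =>
    (hφ.continuous.mul ha.1.continuous).integrable_of_hasCompactSupport hφc.mul_right
  simp only [Pi.sub_apply, mul_sub]
  rw [integral_sub (hint u hu) (hint u' hu'), ← edist_eq_enorm_sub]
  exact (isLocallyLipschitzFunctional_integral_mul hφ.continuous hφc).edist_le_distStar
    (edist_integral_mul_le_pathDist ht hφ hφc hφ1) u u'

theorem kantorovichRubinstein_le_distStar (ht : t ∈ Icc 0 T) {u u' : ℝ → ℝ} (hu : MemSpace u)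
    (hu' : MemSpace u') : kantorovichRubinstein u u' ≤ distStar T t E₁ E₂ u u' := by
  simp only [kantorovichRubinstein, iSup_le_iff]
  intro f hf hf1 hf'
  rw [← Real.enorm_eq_ofReal_abs]
  refine enorm_integral_mul_le_of_hasCompactSupport (hu.1.integrable_density_sub hu'.1)
    (fun g hg hgc hg1 hg' => ?_) hf hf1 hf'
  simp only [mul_sub]
  rw [integral_sub (hu.1.integrable_mul_density hg.continuous hgc)
    (hu'.1.integrable_mul_density hg.continuous hgc), ← edist_eq_enorm_sub]
  exact (isLocallyLipschitzFunctional_integral_density hg.continuous hgc hg1).edist_le_distStar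
    (edist_integral_density_le_pathDist ht hg hgc hg1 hg') u u'

/-! ### `distStar` is a distance -/

theorem isPiecewiseRegular_reverse {B : Finset ℝ} {S : ℝ → CharData}
    (hp : IsPiecewiseRegular T B S) :
    IsPiecewiseRegular T (B.image fun θ => 1 - θ) fun θ => S (1 - θ) := by
  have hI : ∀ θ ∈ Icc (0 : ℝ) 1, 1 - θ ∈ Icc (0 : ℝ) 1 := fun θ hθ =>
    ⟨by linarith [hθ.2], by linarith [hθ.1]⟩
  have hB : ∀ θ, θ ∉ ((B.image fun θ => 1 - θ : Finset ℝ) : Set ℝ) → 1 - θ ∉ (B : Set ℝ) :=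
    fun θ hθ h => hθ (Finset.mem_coe.2 (Finset.mem_image.2 ⟨1 - θ, h, by ring⟩))
  refine ⟨fun θ hθ => hp.solution _ (hI θ hθ), fun t ht => ?_, fun t ht => ?_, fun θ hθ =>
    hp.generic _ ⟨hI θ hθ.1, hB θ hθ.2⟩⟩
  · exact (hp.cont t ht).comp (f := fun p : ℝ × ℝ => (p.1, 1 - p.2)) (by fun_prop)
      fun p h => ⟨mem_univ _, hI _ h.2⟩
  · exact (hp.smooth t ht).comp (f := fun p : ℝ × ℝ => (p.1, 1 - p.2)) (by fun_prop)
      fun p h => ⟨mem_univ _, ⟨by linarith [h.2.1.2], by linarith [h.2.1.1]⟩, hB _ h.2.2⟩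

/-- Under `θ ↦ 1 - θ` both the `θ`-derivatives and the shift change sign. -/
theorem tangentNorm_reverse (S : ℝ → CharData) (q : ℝ → ℝ) (θ : ℝ) :
    tangentNorm (fun η => S (1 - η)) t θ (fun Y => -q Y) = tangentNorm S t (1 - θ) q := by
  have hd : ∀ g : ℝ → ℝ, deriv (fun η => g (1 - η)) θ = -deriv g (1 - θ) := fun g =>
    deriv_comp_const_sub g 1 θ
  have hq : ∀ Y, deriv (fun Y => -q Y) Y = -deriv q Y := fun Y => deriv.fun_neg
  unfold tangentNorm
  simp only [hq]
  congr 1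
  · congr 1
    · congr 1
      · congr 1 with Y
        rw [hd (fun η => (S η).x t Y), ← abs_neg]
        ring_nf
      · congr 1 with Y
        rw [hd (fun η => (S η).u t Y), ← abs_neg]
        ring_nf
    · congr 1 with Y
      rw [hd (fun η => (S η).α t Y), ← abs_neg]
      ring_nf
  · congr 1 with Y
    rw [hd (fun η => (S η).ξ t Y), ← abs_neg]
    ring_nf

theorem setLIntegral_Ioo_one_sub (N : ℝ → ℝ≥0∞) :
    ∫⁻ θ in Ioo (0 : ℝ) 1, N (1 - θ) = ∫⁻ θ in Ioo (0 : ℝ) 1, N θ := by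
  rw [← lintegral_indicator measurableSet_Ioo, ← lintegral_indicator measurableSet_Ioo,
    ← lintegral_sub_left_eq_self _ (1 : ℝ)]
  congr 1 with θ
  by_cases h : θ ∈ Ioo (0 : ℝ) 1
  · rw [indicator_of_mem h, indicator_of_mem (by constructor <;> linarith [h.1, h.2]),
      sub_sub_cancel]
  · rw [indicator_of_notMem h, indicator_of_notMem]
    exact fun h' => h ⟨by linarith [h'.2], by linarith [h'.1]⟩

theorem pathDist_le_swap (a b : ℝ → ℝ) :
    pathDist T t E₁ E₂ a b ≤ pathDist T t E₁ E₂ b a := by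
  conv_rhs => unfold pathDist
  simp only [le_iInf_iff]
  intro S B q hp h0 h1 hmem hq
  have hle : pathDist T t E₁ E₂ a b ≤ ∫⁻ θ in Ioo (0 : ℝ) 1,
      tangentNorm (fun η => S (1 - η)) t θ (fun Y => -q (1 - θ) Y) := by
    unfold pathDist
    refine iInf₂_le_of_le (fun η => S (1 - η)) (B.image fun θ => 1 - θ) <|
      iInf₂_le_of_le (fun θ Y => -q (1 - θ) Y) (isPiecewiseRegular_reverse hp) <|
      iInf₂_le_of_le (by simpa using h1) (by simpa using h0) <|
      iInf₂_le_of_le (fun θ hθ => hmem _ ⟨by linarith [hθ.2], by linarith [hθ.1]⟩) ?_ le_rfl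
    refine (hq.comp (f := fun p : ℝ × ℝ => (p.1, 1 - p.2)) (by fun_prop) fun p h => ?_).neg
    refine ⟨mem_univ _, ⟨by linarith [h.2.1.2], by linarith [h.2.1.1]⟩, fun h' => h.2.2 ?_⟩
    exact Finset.mem_coe.2 (Finset.mem_image.2 ⟨1 - p.2, h', by ring⟩)
  refine hle.trans_eq ?_
  simp only [tangentNorm_reverse]
  exact setLIntegral_Ioo_one_sub fun θ => tangentNorm S t θ (q θ)

theorem limitDist_comm (u u' : ℝ → ℝ) :
    limitDist T t E₁ E₂ u u' = limitDist T t E₁ E₂ u' u := by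
  have key : ∀ u u', limitDist T t E₁ E₂ u u' ≤ limitDist T t E₁ E₂ u' u := fun u u' =>
    iSup₂_mono fun ε _ => le_iInf fun b => le_iInf fun a => le_iInf fun hb => le_iInf fun ha =>
      iInf₂_le_of_le a b <| iInf₂_le_of_le ha hb <| pathDist_le_swap a b
  exact le_antisymm (key u u') (key u' u)

theorem distStar_self {u : ℝ → ℝ} (hu : MemSpace u) : distStar T t E₁ E₂ u u = 0 :=
  le_antisymm (iInf₂_le_of_le 0 (fun _ => u) <| iInf₂_le_of_le (fun _ _ => hu) rfl <|
    iInf_le_of_le rfl (by simp)) bot_le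

theorem distStar_comm (u u' : ℝ → ℝ) : distStar T t E₁ E₂ u u' = distStar T t E₁ E₂ u' u := by
  have key : ∀ u u', distStar T t E₁ E₂ u u' ≤ distStar T t E₁ E₂ u' u := by
    intro u u'
    conv_rhs => unfold distStar
    simp only [le_iInf_iff]
    rintro n w hw rfl rfl
    refine iInf₂_le_of_le n (fun i => w (n - i)) <| iInf₂_le_of_le
      (fun i _ => hw _ (n.sub_le i)) (by simp) <| iInf_le_of_le (by simp) ?_
    rw [← Finset.sum_range_reflect]
    refine (Finset.sum_congr rfl fun i hi => ?_).le
    rw [Finset.mem_range] at hi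
    beta_reduce
    rw [limitDist_comm, show n - (n - 1 - i + 1) = i by omega,
      show n - (n - 1 - i) = i + 1 by omega]
  exact le_antisymm (key u u') (key u' u)

theorem distStar_triangle (u u' u'' : ℝ → ℝ) :
    distStar T t E₁ E₂ u u'' ≤ distStar T t E₁ E₂ u u' + distStar T t E₁ E₂ u' u'' := by
  conv_rhs => unfold distStar
  simp only [ENNReal.iInf_add, ENNReal.add_iInf, le_iInf_iff]
  rintro m w' hw' h0 rfl n w hw rfl hn
  have hle : ∀ i ≤ n, (if i ≤ n then w i else w' (i - n)) = w i := fun i hi => if_pos hi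
  have hge : ∀ i, (if n + i ≤ n then w (n + i) else w' (n + i - n)) = w' i := by
    intro i
    rcases Nat.eq_zero_or_pos i with rfl | hi
    · simp [hn, h0]
    · rw [if_neg (by omega), Nat.add_sub_cancel_left]
  refine iInf₂_le_of_le (n + m) (fun i => if i ≤ n then w i else w' (i - n)) <|
    iInf₂_le_of_le (fun i hi => ?_) (by simp) <| iInf_le_of_le (hge m) ?_
  · beta_reduce
    split_ifs with h
    · exact hw i h
    · exact hw' _ (by omega)
  · rw [Finset.sum_range_add]
    refine (congrArg₂ (· + ·) (Finset.sum_congr rfl fun i hi => ?_)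
      (Finset.sum_congr rfl fun i _ => ?_)).le
    · rw [Finset.mem_range] at hi
      beta_reduce
      rw [hle i hi.le, hle (i + 1) hi]
    · beta_reduce
      rw [hge i, add_assoc, hge (i + 1)]

theorem eq_of_distStar_eq_zero (ht : t ∈ Icc 0 T) {u u' : ℝ → ℝ} (hu : MemSpace u)
    (hu' : MemSpace u') (h : distStar T t E₁ E₂ u u' = 0) : u = u' := by
  have hz : eLpNorm (u - u') 1 volume = 0 :=
    le_antisymm ((eLpNorm_one_sub_le_distStar ht hu hu').trans_eq h) bot_le
  rw [eLpNorm_eq_zero_iff (hu.2.sub hu'.2).1 one_ne_zero] at hz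
  refine Continuous.ae_eq_iff_eq volume hu.1.continuous hu'.1.continuous |>.1 ?_
  filter_upwards [hz] with x hx using sub_eq_zero.1 hx

end Novikov

theorem proposition7p3 (E₁ E₂ : ℝ) (hE₁ : 0 < E₁) (hE₂ : 0 < E₂) :
    -- `d*` is an extended distance on `H¹ ∩ W^{1,4} ∩ L¹`
    (∀ (T t : ℝ), 0 < T → t ∈ Set.Icc 0 T →
      (∀ u u' : ℝ → ℝ, Novikov.MemSpace u → Novikov.MemSpace u' →
        (Novikov.distStar T t E₁ E₂ u u' = 0 ↔ u = u') ∧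
        Novikov.distStar T t E₁ E₂ u u' = Novikov.distStar T t E₁ E₂ u' u) ∧
      (∀ u u' u'' : ℝ → ℝ,
        Novikov.MemSpace u → Novikov.MemSpace u' → Novikov.MemSpace u'' →
        Novikov.distStar T t E₁ E₂ u u''
          ≤ Novikov.distStar T t E₁ E₂ u u' + Novikov.distStar T t E₁ E₂ u' u'')) ∧
    -- comparison with the `L¹` distance
    (∃ C : ℝ, 0 < C ∧
      ∀ (T t : ℝ), 0 < T → t ∈ Set.Icc 0 T →
      ∀ u u' : ℝ → ℝ, Novikov.MemSpace u → Novikov.MemSpace u' →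
        MeasureTheory.eLpNorm (fun x => u x - u' x) 1 MeasureTheory.volume
          ≤ ENNReal.ofReal C * Novikov.distStar T t E₁ E₂ u u') ∧
    -- comparison with the Kantorovich-Rubinstein distance
    (∀ (T t : ℝ), 0 < T → t ∈ Set.Icc 0 T →
      ∀ u u' : ℝ → ℝ, Novikov.MemSpace u → Novikov.MemSpace u' →
        MeasureTheory.Integrable (fun x => Novikov.density u x - Novikov.density u' x) ∧
        Novikov.kantorovichRubinstein u u' ≤ Novikov.distStar T t E₁ E₂ u u') := by
  refine ⟨fun T t _ ht => ⟨fun u u' hu hu' => ⟨⟨Novikov.eq_of_distStar_eq_zero ht hu hu', ?_⟩,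
    Novikov.distStar_comm u u'⟩, fun u u' u'' _ _ _ => Novikov.distStar_triangle u u' u''⟩,
    ⟨1, one_pos, fun T t _ ht u u' hu hu' => ?_⟩, fun T t _ ht u u' hu hu' =>
    ⟨hu.1.integrable_density_sub hu'.1, Novikov.kantorovichRubinstein_le_distStar ht hu hu'⟩⟩
  · rintro rfl
    exact Novikov.distStar_self hu
  · rw [ENNReal.ofReal_one, one_mul]
    exact Novikov.eLpNorm_one_sub_le_distStar ht hu hu'
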